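/- Let $X,Y,Z$ be the Pauli matrices. The family of observables $$\mathcal F_2=\{Z\otimes X,\ Z\}\cup\{\cos(\theta)X+\sin(\theta)Y:\theta\in[0,2\pi]\}$$ is (exactly) quantum universal, in the following sense. Let $\mathcal F$ be a family of observables with eigenvalues $\pm1$, each acting on finitely many qubits. A *measurement program* over $\mathcal F$ on a register of qubits is a classical flowchart with finitely many control locations. At each location the program either stops with a classical result, or performs the projective measurement of an observable $O\in\mathcal F$ on chosen distinct qubits of the register (projections $\frac{1}{2}(I\pm O)$, tensored with the identity on the other qubits) and moves to a location that depends on the outcome; loops are allowed. An operation on $n$ qubits is given by matrices $(A_k)_k$, where $k$ is the classical result and a state $\varphi$ becomes $A_k\varphi$ up to normalization; a unitary $U$ is the operation with the single matrix $U$, and a projective measurement is given by orthogonal projections $(P_k)_{k}$, finite in number, with $\sum_kP_k=I$. The family $\mathcal F$ *simulates* $(A_k)_k$ if there are $m\ge 0$ and a measurement program over $\mathcal F$ on $n+m$ qubits (the $n$ given qubits and $m$ auxiliary ones) such that 1. from every initial state, the program stops with probability one; 2. for every sequence of outcomes after which the program stops, with result $k$ say, let $B$ be the product of the corresponding projections.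 Then for every initial state $\chi$ of the auxiliary qubits there is a vector $\chi'$ such that $B(\varphi\otimes\chi)=(A_k\varphi)\otimes\chi'$ for all states $\varphi$ of the $n$ qubits. The family $\mathcal F$ is *quantum universal* if, for every $n\ge 0$, it simulates every unitary transformation of $n$ qubits and every projective measurement on $n$ qubits. -/

import Mathlib

open scoped Matrix

noncomputable section

namespace MBQC

/-- Operators on a register whose qubits are labelled by `ι`, as matrices in the computational
basis `ι → Fin 2`. -/
abbrev Op (ι : Type) := Matrix (ι → Fin 2) (ι → Fin 2) ℂ

/-- (Not necessarily normalized) state vectors of a register. -/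
abbrev Vec (ι : Type) := (ι → Fin 2) → ℂ

/-- The product state `φ ⊗ χ` of two registers. -/
def tensorVec {ι κ : Type} (φ : Vec ι) (χ : Vec κ) : Vec (ι ⊕ κ) :=
  fun x => φ (fun i => x (Sum.inl i)) * χ (fun j => x (Sum.inr j))

/-- `M 0 ⊗ ⋯ ⊗ M (k-1)`. -/
def tensorOp {k : ℕ} (M : Fin k → Matrix (Fin 2) (Fin 2) ℂ) : Op (Fin k) :=
  fun x y => ∏ i, M i (x i) (y i)

/-- A `k`-qubit observable with eigenvalues in `{1, -1}`. -/
structure Observable (k : ℕ) where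
  mat : Op (Fin k)
  isHermitian : mat.IsHermitian
  mul_self : mat * mat = 1

theorem tensorOp_isHermitian {k : ℕ} {M : Fin k → Matrix (Fin 2) (Fin 2) ℂ}
    (h : ∀ i, (M i).IsHermitian) : (tensorOp M).IsHermitian := by
  ext x y
  simp only [tensorOp, Matrix.conjTranspose_apply, star_prod]
  exact Finset.prod_congr rfl fun i _ => (h i).apply (x i) (y i)

theorem tensorOp_mul_self {k : ℕ} {M : Fin k → Matrix (Fin 2) (Fin 2) ℂ}
    (h : ∀ i, M i * M i = 1) : tensorOp M * tensorOp M = 1 := by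
  ext x y
  have key : ∏ i, (M i * M i) (x i) (y i) = (tensorOp M * tensorOp M) x y := by
    simp only [Matrix.mul_apply, tensorOp, ← Finset.prod_mul_distrib]
    rw [Finset.prod_univ_sum]
    simp
  rw [← key]
  simp only [h, Matrix.one_apply]
  by_cases hxy : x = y
  · simp [hxy]
  · obtain ⟨i, hi⟩ := Function.ne_iff.mp hxy
    rw [if_neg hxy]
    exact Finset.prod_eq_zero (Finset.mem_univ i) (if_neg hi)

/-- The tensor product of one-qubit observables. -/
def Observable.tensor {k : ℕ} (M : Fin k → Matrix (Fin 2) (Fin 2) ℂ)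
    (h₁ : ∀ i, (M i).IsHermitian) (h₂ : ∀ i, M i * M i = 1) : Observable k :=
  ⟨tensorOp M, tensorOp_isHermitian h₁, tensorOp_mul_self h₂⟩

def pauliX : Matrix (Fin 2) (Fin 2) ℂ := !![0, 1; 1, 0]
def pauliY : Matrix (Fin 2) (Fin 2) ℂ := !![0, -Complex.I; Complex.I, 0]
def pauliZ : Matrix (Fin 2) (Fin 2) ℂ := !![1, 0; 0, -1]

/-- `cos θ X + sin θ Y`. -/
def planar (θ : ℝ) : Matrix (Fin 2) (Fin 2) ℂ :=
  (Real.cos θ : ℂ) • pauliX + (Real.sin θ : ℂ) • pauliY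

theorem pauliX_isHermitian : pauliX.IsHermitian := by
  ext i j; fin_cases i <;> fin_cases j <;> simp [pauliX]

theorem pauliZ_isHermitian : pauliZ.IsHermitian := by
  ext i j; fin_cases i <;> fin_cases j <;> simp [pauliZ]

theorem planar_isHermitian (θ : ℝ) : (planar θ).IsHermitian := by
  ext i j
  fin_cases i <;> fin_cases j <;>
    simp [planar, pauliX, pauliY, -Complex.ofReal_cos, -Complex.ofReal_sin]

theorem pauliX_mul_self : pauliX * pauliX = 1 := by
  ext i j; fin_cases i <;> fin_cases j <;> simp [pauliX]

theorem pauliZ_mul_self : pauliZ * pauliZ = 1 := by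
  ext i j; fin_cases i <;> fin_cases j <;> simp [pauliZ]

theorem planar_mul_self (θ : ℝ) : planar θ * planar θ = 1 := by
  have h : Complex.cos θ ^ 2 + Complex.sin θ ^ 2 = 1 := Complex.cos_sq_add_sin_sq _
  have hI : Complex.I ^ 2 = -1 := Complex.I_sq
  ext i j
  fin_cases i <;> fin_cases j <;>
    simp [planar, pauliX, pauliY, Matrix.mul_apply, Fin.sum_univ_two] <;>
    linear_combination h - (Complex.sin θ) ^ 2 * hI

/-- The two-qubit observable `Z ⊗ X`. -/
def obsZX : Observable 2 :=
  Observable.tensor ![pauliZ, pauliX]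
    (by intro i; fin_cases i; exacts [pauliZ_isHermitian, pauliX_isHermitian])
    (by intro i; fin_cases i; exacts [pauliZ_mul_self, pauliX_mul_self])

/-- The one-qubit observable `Z`. -/
def obsZ : Observable 1 :=
  Observable.tensor (fun _ => pauliZ) (fun _ => pauliZ_isHermitian) (fun _ => pauliZ_mul_self)

/-- The one-qubit observable `cos θ X + sin θ Y`. -/
def obsPlanar (θ : ℝ) : Observable 1 :=
  Observable.tensor (fun _ => planar θ) (fun _ => planar_isHermitian θ)
    (fun _ => planar_mul_self θ)

/-- The family `{Z ⊗ X, Z} ∪ {cos θ X + sin θ Y : θ ∈ [0, 2π]}`. -/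
def F2 : Set (Σ k, Observable k) :=
  {⟨2, obsZX⟩, ⟨1, obsZ⟩} ∪
    (fun θ : ℝ => (⟨1, obsPlanar θ⟩ : Σ k, Observable k)) '' Set.Icc 0 (2 * Real.pi)

open Classical in
/-- The `k`-qubit operator `M` acting on the qubits `e 0, …, e (k-1)` of a register, tensored with
the identity on all other qubits. -/
def onQubits {ι : Type} {k : ℕ} (e : Fin k ↪ ι) (M : Op (Fin k)) : Op ι :=
  fun x y => if ∀ i, i ∉ Set.range e → x i = y i then M (fun j => x (e j)) (fun j => y (e j)) else 0

/-- The spectral projection of the observable `O`, measured on the qubits `e`, for the outcome `+1`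
(`s = true`) or `-1` (`s = false`). -/
def outcomeProj {ι : Type} [Fintype ι] [DecidableEq ι] {k : ℕ} (O : Observable k) (e : Fin k ↪ ι)
    (s : Bool) : Op ι :=
  (1 / 2 : ℂ) • (1 + (if s then (1 : ℂ) else -1) • onQubits e O.mat)

/-- An instruction of a measurement program on the register `ι`, with control locations `Q` and
classical results `κ`: either stop with a classical result, or measure an observable of `F` on some
qubits and go to a location that depends on the outcome. -/
inductive Instr (F : Set (Σ k, Observable k)) (ι κ Q : Type) : Type
  | halt (result : κ) : Instr F ι κ Q
  | measure (O : Σ k, Observable k) (hO : O ∈ F) (e : Fin O.1 ↪ ι) (next : Bool → Q) :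
      Instr F ι κ Q

/-- A classically controlled combination of measurements of observables of `F`: a flowchart with
finitely many control locations. Loops are allowed. -/
structure Program (F : Set (Σ k, Observable k)) (ι κ : Type) where
  Q : Type
  finite : Finite Q
  start : Q
  instr : Q → Instr F ι κ Q

variable {F : Set (Σ k, Observable k)} {ι κ : Type} [Fintype ι] [DecidableEq ι]

/-- `P.HaltsWith q k B`: there is a sequence of outcomes along which `P`, started at `q`, stops with
classical result `k`, and `B` is the product of the projections for these outcomes; that is, the
initial state `ψ` becomes the unnormalized state `B ψ`. -/
inductive Program.HaltsWith (P : Program F ι κ) : P.Q → κ → Op ι → Prop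
  | halt {q : P.Q} {k : κ} (h : P.instr q = .halt k) : Program.HaltsWith P q k 1
  | measure {q : P.Q} {O : Σ k, Observable k} {hO : O ∈ F} {e : Fin O.1 ↪ ι} {next : Bool → P.Q}
      (h : P.instr q = .measure O hO e next) (s : Bool) {k : κ} {B : Op ι}
      (hB : Program.HaltsWith P (next s) k B) :
      Program.HaltsWith P q k (B * outcomeProj O.2 e s)

/-- The probability (Born rule, scaled by the squared norm of `ψ`) that `P`, started at `q` in the
state `ψ`, has not stopped after `t` measurements. -/
def Program.runningProb (P : Program F ι κ) : ℕ → P.Q → Vec ι → ℝ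
  | 0, q, ψ =>
    match P.instr q with
    | .halt _ => 0
    | .measure _ _ _ _ => ∑ x, ‖ψ x‖ ^ 2
  | t + 1, q, ψ =>
    match P.instr q with
    | .halt _ => 0
    | .measure O _ e next => ∑ s : Bool, P.runningProb t (next s) (outcomeProj O.2 e s *ᵥ ψ)

/-- The family `F` simulates, exactly, the operation on `n` qubits which has the possible classical
results `k : κ` and transforms the state `φ` into `A k φ` (up to a scalar) when the result is `k`.
There are `m` auxiliary qubits and a program that stops with probability one; whatever the
initial state `χ` of the auxiliary qubits, whenever it stops, with result `k`, the `n` qubits are in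
the state `A k φ` up to a scalar and in product with the auxiliary qubits. The state `χ'`, into
which the scalar is absorbed, does not depend on `φ`. -/
def Simulates (F : Set (Σ k, Observable k)) {n : ℕ} {κ : Type} (A : κ → Op (Fin n)) : Prop :=
  ∃ (m : ℕ) (P : Program F (Fin n ⊕ Fin m) κ),
    (∀ ψ : Vec (Fin n ⊕ Fin m),
      Filter.Tendsto (fun t => P.runningProb t P.start ψ) Filter.atTop (nhds 0)) ∧
    ∀ (k : κ) (B : Op (Fin n ⊕ Fin m)), P.HaltsWith P.start k B →
      ∀ χ : Vec (Fin m), ∃ χ' : Vec (Fin m), ∀ φ : Vec (Fin n),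
        B *ᵥ tensorVec φ χ = tensorVec (A k *ᵥ φ) χ'

/-- `F` is (exactly) quantum universal: it simulates every unitary transformation and every
projective measurement on any number of qubits. -/
def IsQuantumUniversal (F : Set (Σ k, Observable k)) : Prop :=
  ∀ n : ℕ,
    (∀ U ∈ Matrix.unitaryGroup (Fin n → Fin 2) ℂ, Simulates F (fun _ : Unit => U)) ∧
    (∀ (r : ℕ) (p : Fin r → Op (Fin n)), (∀ k, IsStarProjection (p k)) → ∑ k, p k = 1 →
      Simulates F p)

end MBQC

end

open scoped Matrix

noncomputable section

set_option linter.unusedSectionVars false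

namespace MBQC

/-! Outcomes are random, so each gate of an exactly universal set must be obtained, up to a scalar,
along every halting run. Two mechanisms achieve this with one auxiliary qubit. Let `O` and `O'` be
anticommuting involutions. Measuring `O`, `O'`, `O` either repeats the first outcome and rescales
the state, or changes it and applies `O'` (`specProj_conj_eq`, `specProj_conj_ne`). Repeating until
the outcome changes succeeds with probability one (`Impl.flip`). With `O'` an instance of Z ⊗ X that
involves the auxiliary qubit, and `O` equal to X or Y on that qubit, this yields the Pauli gates Z
and X. A Z ⊗ X measurement between auxiliary measurements, or two of them with a planar measurement
in between, yields 1 + iX, CNOT and the phase gates up to Pauli errors that the outcomes determine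
(`sandwich_ten`, `sandwich_ten_mul_ten`); the exact Pauli gates remove the errors.

These gates generate the unitary group without approximation. Conjugating a phase gate by CNOTs
gives exp(iα·parity) for every parity function. Parities span the real functions on the basis states
(Walsh expansion), so every diagonal unitary is available (`isPhase`, `gate_diagonal`). Diagonal
unitaries conjugated by √X are rotations of one qubit controlled by all others; they carry any
vector to a multiple of the zero basis state (`exists_gate_mulVec_eq_single`). Hence all complex
reflections are available (`gate_reflection`), and Householder's argument reaches every unitary
(`gate_of_fixed`).

A projection p is measured by applying the unitary p ⊗ X + (1 - p) ⊗ 1 to the system and a flag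
qubit, and comparing Z on the flag before and after (`impl_projection`). A projective measurement
tests its projections one by one.

Programs are composed through `Impl`, whose termination is uniform in the state so that it survives
composition. -/

/-! ### Norms and projections -/

section Norm

variable {ι : Type} [Fintype ι] [DecidableEq ι]

/-- The squared norm of a state vector. -/
def normSq (ψ : Vec ι) : ℝ := ∑ x, ‖ψ x‖ ^ 2

theorem normSq_nonneg (ψ : Vec ι) : 0 ≤ normSq ψ :=
  Finset.sum_nonneg fun _ _ => sq_nonneg _

theorem eq_zero_of_normSq_eq_zero {ψ : Vec ι} (h : normSq ψ = 0) : ψ = 0 := by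
  rw [normSq, Finset.sum_eq_zero_iff_of_nonneg fun _ _ => sq_nonneg _] at h
  exact funext fun x => by simpa using h x (Finset.mem_univ x)

theorem ofReal_normSq (ψ : Vec ι) : ((normSq ψ : ℝ) : ℂ) = star ψ ⬝ᵥ ψ := by
  simp [normSq, dotProduct, Complex.conj_mul']

theorem normSq_smul (c : ℂ) (ψ : Vec ι) : normSq (c • ψ) = ‖c‖ ^ 2 * normSq ψ := by
  simp [normSq, mul_pow, Finset.mul_sum]

theorem normSq_mulVec {U : Op ι} (hU : Uᴴ * U = 1) (ψ : Vec ι) :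
    normSq (U *ᵥ ψ) = normSq ψ := by
  have : ((normSq (U *ᵥ ψ) : ℝ) : ℂ) = normSq ψ := by
    rw [ofReal_normSq, ofReal_normSq, Matrix.star_mulVec, Matrix.dotProduct_mulVec,
      Matrix.vecMul_vecMul, hU, Matrix.vecMul_one]
  exact_mod_cast this

end Norm

/-! ### Operators on some of the qubits of a register -/

section OnQubits

variable {ι : Type} {k : ℕ}

theorem onQubits_conjTranspose (e : Fin k ↪ ι) (M : Op (Fin k)) :
    (onQubits e M)ᴴ = onQubits e Mᴴ := by
  ext x y
  simp only [onQubits, Matrix.conjTranspose_apply]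
  by_cases h : ∀ i, i ∉ Set.range e → x i = y i
  · rw [if_pos h, if_pos fun i hi => (h i hi).symm]
  · rw [if_neg h, if_neg fun h' => h fun i hi => (h' i hi).symm, star_zero]

variable [Fintype ι] [DecidableEq ι]

theorem onQubits_one (e : Fin k ↪ ι) : onQubits e (1 : Op (Fin k)) = 1 := by
  ext x y
  simp only [onQubits, Matrix.one_apply]
  by_cases h : x = y
  · simp [h]
  · rw [if_neg h]
    split_ifs with h₁ h₂
    · refine (h (funext fun i => ?_)).elim
      by_cases hi : i ∈ Set.range e
      · obtain ⟨j, rfl⟩ := hi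
        exact congrFun h₂ j
      · exact h₁ i hi
    · rfl
    · rfl

open Classical in
theorem onQubits_mul (e : Fin k ↪ ι) (M N : Op (Fin k)) :
    onQubits e M * onQubits e N = onQubits e (M * N) := by
  ext x y
  simp only [Matrix.mul_apply]
  -- The intermediate basis states with a nonzero term agree with `x` off the chosen qubits; `f`
  -- enumerates them by their bits there.
  let f : (Fin k → Fin 2) → (ι → Fin 2) := fun u => Function.extend e u x
  have hf : ∀ u j, f u (e j) = u j := fun u j => e.injective.extend_apply _ _ _
  have hf' : ∀ u i, i ∉ Set.range e → f u i = x i := fun u i hi =>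
    Function.extend_apply' _ _ _ (by simpa using hi)
  have hinj : Function.Injective f := fun u v h => funext fun j => by
    rw [← hf u, ← hf v, h]
  rw [← Finset.sum_subset (Finset.subset_univ (Finset.univ.image f)),
    Finset.sum_image hinj.injOn]
  · simp only [onQubits, hf]
    by_cases h : ∀ i, i ∉ Set.range e → x i = y i
    · rw [if_pos h, Matrix.mul_apply]
      refine Finset.sum_congr rfl fun u _ => ?_
      rw [if_pos fun i hi => (hf' u i hi).symm, if_pos fun i hi => (hf' u i hi).trans (h i hi)]
    · rw [if_neg h]
      refine Finset.sum_eq_zero fun u _ => ?_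
      rw [if_neg (c := ∀ i, i ∉ Set.range e → f u i = y i), mul_zero]
      exact fun h' => h fun i hi => (hf' u i hi).symm.trans (h' i hi)
  · intro z _ hz
    rw [onQubits, if_neg, zero_mul]
    intro h
    refine hz (Finset.mem_image.2 ⟨fun j => z (e j), Finset.mem_univ _, funext fun i => ?_⟩)
    by_cases hi : i ∈ Set.range e
    · obtain ⟨j, rfl⟩ := hi
      exact hf _ j
    · exact (hf' _ i hi).trans (h i hi)

theorem onQubits_mat_mul_self (O : Observable k) (e : Fin k ↪ ι) :
    onQubits e O.mat * onQubits e O.mat = 1 := by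
  rw [onQubits_mul, O.mul_self, onQubits_one]

/-- The spectral projection of an involution `O` for the eigenvalue `1` or `-1`. -/
def specProj (O : Op ι) (s : Bool) : Op ι :=
  (1 / 2 : ℂ) • (1 + (if s then (1 : ℂ) else -1) • O)

/-- The parallelogram law, applied to each pair of amplitudes of ψ and Oψ, together with unitarity
of O: the Born probabilities of the two outcomes add up. -/
theorem normSq_outcomeProj_add (O : Observable k) (e : Fin k ↪ ι) (ψ : Vec ι) :
    ∑ s, normSq (outcomeProj O e s *ᵥ ψ) = normSq ψ := by
  have h : normSq (onQubits e O.mat *ᵥ ψ) = normSq ψ :=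
    normSq_mulVec (by rw [onQubits_conjTranspose, O.isHermitian.eq, onQubits_mat_mul_self]) ψ
  have key : ∀ a b : ℂ, ‖(1 / 2 : ℂ) * (a + b)‖ ^ 2 + ‖(1 / 2 : ℂ) * (a - b)‖ ^ 2
      = (‖a‖ ^ 2 + ‖b‖ ^ 2) / 2 := by
    intro a b
    have := parallelogram_law_with_norm ℝ a b
    rw [norm_mul, norm_mul]
    norm_num
    linarith
  have : ∑ s, normSq (outcomeProj O e s *ᵥ ψ)
      = (normSq ψ + normSq (onQubits e O.mat *ᵥ ψ)) / 2 := by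
    simp only [Fintype.sum_bool, normSq, ← Finset.sum_add_distrib, Finset.sum_div]
    refine Finset.sum_congr rfl fun x _ => ?_
    rw [← key]
    simp only [outcomeProj, Matrix.smul_mulVec, Matrix.add_mulVec, Matrix.one_mulVec,
      Pi.smul_apply, Pi.add_apply, smul_eq_mul, if_true, Bool.false_eq_true, if_false, one_mul,
      neg_one_mul, sub_eq_add_neg]
  rw [this, h]
  ring

end OnQubits

/-! ### Termination -/

section Calculus

variable {F : Set (Σ k, Observable k)} {ι κ ℓ : Type} [Fintype ι] [DecidableEq ι]

namespace Program

theorem runningProb_of_halt (P : Program F ι κ) {q : P.Q} {k : κ} (h : P.instr q = .halt k)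
    (t : ℕ) (ψ : Vec ι) : P.runningProb t q ψ = 0 := by
  cases t <;> simp [runningProb, h]

theorem runningProb_zero_of_measure (P : Program F ι κ) {q : P.Q} {O : Σ k, Observable k}
    {hO : O ∈ F} {e : Fin O.1 ↪ ι} {next : Bool → P.Q} (h : P.instr q = .measure O hO e next)
    (ψ : Vec ι) : P.runningProb 0 q ψ = normSq ψ := by
  simp [runningProb, h, normSq]

theorem runningProb_succ_of_measure (P : Program F ι κ) {q : P.Q} {O : Σ k, Observable k}
    {hO : O ∈ F} {e : Fin O.1 ↪ ι} {next : Bool → P.Q} (h : P.instr q = .measure O hO e next)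
    (t : ℕ) (ψ : Vec ι) : P.runningProb (t + 1) q ψ =
      ∑ s, P.runningProb t (next s) (outcomeProj O.2 e s *ᵥ ψ) := by
  simp [runningProb, h]

theorem runningProb_nonneg (P : Program F ι κ) (t : ℕ) (q : P.Q) (ψ : Vec ι) :
    0 ≤ P.runningProb t q ψ := by
  induction t generalizing q ψ with
  | zero =>
    cases h : P.instr q with
    | halt k => rw [P.runningProb_of_halt h]
    | measure O hO e next => rw [P.runningProb_zero_of_measure h]; exact normSq_nonneg ψ
  | succ t ih =>
    cases h : P.instr q with
    | halt k => rw [P.runningProb_of_halt h]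
    | measure O hO e next =>
      rw [P.runningProb_succ_of_measure h]
      exact Finset.sum_nonneg fun s _ => ih _ _

theorem runningProb_le_normSq (P : Program F ι κ) (t : ℕ) (q : P.Q) (ψ : Vec ι) :
    P.runningProb t q ψ ≤ normSq ψ := by
  induction t generalizing q ψ with
  | zero =>
    cases h : P.instr q with
    | halt k => rw [P.runningProb_of_halt h]; exact normSq_nonneg ψ
    | measure O hO e next => rw [P.runningProb_zero_of_measure h]
  | succ t ih =>
    cases h : P.instr q with
    | halt k => rw [P.runningProb_of_halt h]; exact normSq_nonneg ψ
    | measure O hO e next =>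
      rw [P.runningProb_succ_of_measure h, ← normSq_outcomeProj_add O.2 e ψ]
      exact Finset.sum_le_sum fun s _ => ih _ _

theorem runningProb_succ_le (P : Program F ι κ) (t : ℕ) (q : P.Q) (ψ : Vec ι) :
    P.runningProb (t + 1) q ψ ≤ P.runningProb t q ψ := by
  induction t generalizing q ψ with
  | zero =>
    cases h : P.instr q with
    | halt k => simp only [P.runningProb_of_halt h, le_refl]
    | measure O hO e next =>
      rw [P.runningProb_zero_of_measure h]
      exact P.runningProb_le_normSq _ _ _
  | succ t ih =>
    cases h : P.instr q with
    | halt k => simp only [P.runningProb_of_halt h, le_refl]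
    | measure O hO e next =>
      rw [P.runningProb_succ_of_measure h, P.runningProb_succ_of_measure h]
      exact Finset.sum_le_sum fun s _ => ih _ _

theorem runningProb_antitone (P : Program F ι κ) (q : P.Q) (ψ : Vec ι) :
    Antitone fun t => P.runningProb t q ψ :=
  antitone_nat_of_succ_le fun t => P.runningProb_succ_le t q ψ

/-- The program stops with probability one, uniformly in the initial state. -/
def Terminates (P : Program F ι κ) : Prop :=
  ∀ ε > 0, ∃ t, ∀ ψ, P.runningProb t P.start ψ ≤ ε * normSq ψ

theorem Terminates.tendsto {P : Program F ι κ} (h : P.Terminates) (ψ : Vec ι) :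
    Filter.Tendsto (fun t => P.runningProb t P.start ψ) Filter.atTop (nhds 0) := by
  rw [Metric.tendsto_atTop]
  intro ε hε
  have hpos : 0 < normSq ψ + 1 := by have := normSq_nonneg ψ; linarith
  obtain ⟨t, ht⟩ := h (ε / (normSq ψ + 1)) (by positivity)
  refine ⟨t, fun s hs => ?_⟩
  rw [Real.dist_eq, sub_zero, abs_of_nonneg (P.runningProb_nonneg _ _ _)]
  calc P.runningProb s P.start ψ ≤ P.runningProb t P.start ψ := P.runningProb_antitone _ _ hs
    _ ≤ ε / (normSq ψ + 1) * normSq ψ := ht ψ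
    _ < ε / (normSq ψ + 1) * (normSq ψ + 1) := by
      apply mul_lt_mul_of_pos_left _ (by positivity)
      linarith
    _ = ε := by field_simp

end Program

/-! ### Sequential composition -/

/-- Relabel the control locations of an instruction. -/
def Instr.map {Q Q' : Type} (f : Q → Q') : Instr F ι κ Q → Instr F ι κ Q'
  | .halt k => .halt k
  | .measure O hO e next => .measure O hO e (f ∘ next)

namespace Program

/-- Run `P`, then the program `R k` that is chosen according to the result `k` of `P`. -/
def bind [Finite κ] (P : Program F ι κ) (R : κ → Program F ι ℓ) : Program F ι ℓ where
  Q := P.Q ⊕ Σ k, (R k).Q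
  finite := by
    have := P.finite
    have := fun k => (R k).finite
    infer_instance
  start := .inl P.start
  instr
    | .inl q =>
      match P.instr q with
      -- The location where `P` stops itself executes the first instruction of `R k`, so the
      -- junction costs no measurement.
      | .halt k => ((R k).instr (R k).start).map fun q' => .inr ⟨k, q'⟩
      | .measure O hO e next => .measure O hO e fun s => .inl (next s)
    | .inr ⟨k, q⟩ => ((R k).instr q).map fun q' => .inr ⟨k, q'⟩

variable [Finite κ] (P : Program F ι κ) (R : κ → Program F ι ℓ)

theorem bind_instr_inl_of_halt {q : P.Q} {k : κ} (h : P.instr q = .halt k) :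
    (P.bind R).instr (.inl q) = ((R k).instr (R k).start).map fun q' => .inr ⟨k, q'⟩ := by
  simp [bind, h]

theorem bind_instr_inl_of_measure {q : P.Q} {O : Σ k, Observable k} {hO : O ∈ F}
    {e : Fin O.1 ↪ ι} {next : Bool → P.Q} (h : P.instr q = .measure O hO e next) :
    (P.bind R).instr (.inl q) = .measure O hO e fun s => .inl (next s) := by
  simp [bind, h]

theorem bind_runningProb_inr (t : ℕ) (k : κ) (q : (R k).Q) (q' : (P.bind R).Q)
    (hq' : (P.bind R).instr q' = ((R k).instr q).map fun q' => .inr ⟨k, q'⟩) (ψ : Vec ι) :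
    (P.bind R).runningProb t q' ψ = (R k).runningProb t q ψ := by
  induction t generalizing q q' ψ with
  | zero =>
    cases h : (R k).instr q with
    | halt j =>
      rw [h] at hq'
      rw [(R k).runningProb_of_halt h, runningProb_of_halt _ hq']
    | measure O hO e next =>
      rw [h] at hq'
      rw [(R k).runningProb_zero_of_measure h, runningProb_zero_of_measure _ hq']
  | succ t ih =>
    cases h : (R k).instr q with
    | halt j =>
      rw [h] at hq'
      rw [(R k).runningProb_of_halt h, runningProb_of_halt _ hq']
    | measure O hO e next =>
      rw [h] at hq'
      rw [(R k).runningProb_succ_of_measure h, runningProb_succ_of_measure _ hq']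
      exact Finset.sum_congr rfl fun s _ => ih _ _ rfl _

/-- A composite still running after `t + T` measurements either spent more than `t` of them in `P`
or more than `T` in some `R k`. The bound on `R k` must be uniform in the state, since loops in `P`
can hand over infinitely many different states. -/
theorem bind_runningProb_inl_le {T : ℕ} {ε : ℝ} (hε : 0 ≤ ε)
    (hT : ∀ k ψ, (R k).runningProb T (R k).start ψ ≤ ε * normSq ψ) (t : ℕ) (q : P.Q)
    (ψ : Vec ι) :
    (P.bind R).runningProb (t + T) (.inl q) ψ ≤ P.runningProb t q ψ + ε * normSq ψ := by
  have halt : ∀ t q k ψ, P.instr q = .halt k →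
      (P.bind R).runningProb (t + T) (.inl q) ψ ≤ P.runningProb t q ψ + ε * normSq ψ := by
    intro t q k ψ h
    rw [P.runningProb_of_halt h, zero_add,
      P.bind_runningProb_inr R _ k _ _ (P.bind_instr_inl_of_halt R h)]
    exact ((R k).runningProb_antitone _ _ (Nat.le_add_left T t)).trans (hT k ψ)
  induction t generalizing q ψ with
  | zero =>
    cases h : P.instr q with
    | halt k => exact halt _ _ _ _ h
    | measure O hO e next =>
      rw [P.runningProb_zero_of_measure h]
      have := mul_nonneg hε (normSq_nonneg ψ)
      linarith [(P.bind R).runningProb_le_normSq (0 + T) (.inl q) ψ]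
  | succ t ih =>
    cases h : P.instr q with
    | halt k => exact halt _ _ _ _ h
    | measure O hO e next =>
      rw [P.runningProb_succ_of_measure h, Nat.add_right_comm,
        runningProb_succ_of_measure _ (P.bind_instr_inl_of_measure R h),
        ← normSq_outcomeProj_add O.2 e ψ, Finset.mul_sum, ← Finset.sum_add_distrib]
      exact Finset.sum_le_sum fun s _ => ih _ _

theorem Terminates.bind {P : Program F ι κ} {R : κ → Program F ι ℓ} (hP : P.Terminates)
    (hR : ∀ k, (R k).Terminates) : (P.bind R).Terminates := by
  intro ε hε
  obtain ⟨t, ht⟩ := hP (ε / 2) (by positivity)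
  choose T hT using fun k => hR k (ε / 2) (by positivity)
  -- Finiteness of `κ` gives one time bound for all continuations.
  obtain ⟨N, hN⟩ := (Set.finite_range T).bddAbove
  refine ⟨t + N, fun ψ => ?_⟩
  refine (P.bind_runningProb_inl_le R (ε := ε / 2) (by positivity) (fun k ψ => ?_) t _ ψ).trans ?_
  · exact ((R k).runningProb_antitone _ _ (hN ⟨k, rfl⟩)).trans (hT k ψ)
  · linarith [ht ψ]

theorem haltsWith_of_bind_inr {k : κ} {j : ℓ} {B : Op ι} {q' : (P.bind R).Q}
    (h : (P.bind R).HaltsWith q' j B) (q : (R k).Q)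
    (hq' : (P.bind R).instr q' = ((R k).instr q).map fun q' => .inr ⟨k, q'⟩) :
    (R k).HaltsWith q j B := by
  induction h generalizing q with
  | halt h =>
    rw [h] at hq'
    cases hi : (R k).instr q with
    | halt i =>
      simp only [hi, Instr.map, Instr.halt.injEq] at hq'
      exact hq' ▸ .halt hi
    | measure O hO e next => simp [hi, Instr.map] at hq'
  | measure h s hB ih =>
    rw [h] at hq'
    cases hi : (R k).instr q with
    | halt i => simp [hi, Instr.map] at hq'
    | measure O hO e next =>
      simp only [hi, Instr.map, Instr.measure.injEq] at hq'
      obtain ⟨rfl, he, rfl⟩ := hq'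
      obtain rfl := eq_of_heq he
      exact .measure hi s (ih _ rfl)

theorem haltsWith_of_bind_inl {j : ℓ} {B : Op ι} {q' : (P.bind R).Q}
    (h : (P.bind R).HaltsWith q' j B) (q : P.Q) (hq' : q' = .inl q) :
    ∃ k B₁ B₂, P.HaltsWith q k B₁ ∧ (R k).HaltsWith (R k).start j B₂ ∧ B = B₂ * B₁ := by
  induction h generalizing q with
  | @halt q' j h =>
    subst hq'
    cases hi : P.instr q with
    | halt i =>
      exact ⟨i, 1, 1, .halt hi,
        P.haltsWith_of_bind_inr R (.halt h) _ (P.bind_instr_inl_of_halt R hi), by simp⟩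
    | measure O hO e next => simp [P.bind_instr_inl_of_measure R hi] at h
  | @measure q' O hO e next h s j B hB ih =>
    subst hq'
    cases hi : P.instr q with
    | halt i =>
      exact ⟨i, 1, _, .halt hi,
        P.haltsWith_of_bind_inr R (.measure h s hB) _ (P.bind_instr_inl_of_halt R hi), by simp⟩
    | measure O hO e next =>
      obtain ⟨rfl, he, rfl⟩ := Instr.measure.inj ((P.bind_instr_inl_of_measure R hi).symm.trans h)
      obtain rfl := eq_of_heq he
      obtain ⟨k, B₁, B₂, h₁, h₂, rfl⟩ := ih _ rfl
      exact ⟨k, _, B₂, .measure hi s h₁, h₂, (Matrix.mul_assoc _ _ _)⟩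

end Program

/-! ### Specifications -/

/-- Some terminating program over `F` performs, whenever it stops with result `k`, an operator
of `S k`. -/
def Impl (F : Set (Σ k, Observable k)) (S : κ → Set (Op ι)) : Prop :=
  ∃ P : Program F ι κ, P.Terminates ∧ ∀ k B, P.HaltsWith P.start k B → B ∈ S k

theorem Impl.mono {S T : κ → Set (Op ι)} (h : Impl F S) (hST : ∀ k, S k ⊆ T k) : Impl F T := by
  obtain ⟨P, hP, h⟩ := h
  exact ⟨P, hP, fun k B hB => hST k (h k B hB)⟩

theorem Impl.halt {S : κ → Set (Op ι)} (k : κ) (hk : 1 ∈ S k) : Impl F S := by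
  refine ⟨⟨Unit, inferInstance, (), fun _ => .halt k⟩, fun ε hε => ⟨0, fun ψ => ?_⟩, ?_⟩
  · rw [Program.runningProb_of_halt _ (k := k) rfl]
    exact mul_nonneg hε.le (normSq_nonneg ψ)
  · rintro j B (⟨h⟩ | ⟨h, s, hB⟩)
    · obtain rfl : k = j := by simpa using h
      exact hk
    · simp at h

/-- The continuation is specified by its product with every operator the first program may have
performed, as in a weakest precondition; measurement sequences can thus be built from the goal
backwards. -/
theorem Impl.bind [Finite κ] {S : κ → Set (Op ι)} {T : ℓ → Set (Op ι)} (hS : Impl F S)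
    (hT : ∀ k, Impl F fun j => {B | ∀ A ∈ S k, B * A ∈ T j}) : Impl F T := by
  obtain ⟨P, hP, h⟩ := hS
  choose R hR h' using hT
  refine ⟨P.bind R, hP.bind hR, fun j B hB => ?_⟩
  obtain ⟨k, B₁, B₂, h₁, h₂, rfl⟩ := P.haltsWith_of_bind_inl R hB _ rfl
  exact h' k j B₂ h₂ B₁ (h k B₁ h₁)

theorem Impl.measure_outcome (O : Σ k, Observable k) (hO : O ∈ F) (e : Fin O.1 ↪ ι) :
    Impl F fun s : Bool => {outcomeProj O.2 e s} := by
  let P : Program F ι Bool :=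
    ⟨Option Bool, inferInstance, none, fun
      | none => .measure O hO e some
      | some s => .halt s⟩
  refine ⟨P, fun ε hε => ⟨1, fun ψ => ?_⟩, ?_⟩
  · rw [P.runningProb_succ_of_measure (q := P.start) rfl, Finset.sum_eq_zero]
    · exact mul_nonneg hε.le (normSq_nonneg ψ)
    · exact fun s _ => P.runningProb_of_halt (k := s) rfl _ _
  · rintro j B (⟨h⟩ | ⟨h, s, hB⟩)
    · simp [P] at h
    · simp only [P, Instr.measure.injEq] at h
      obtain ⟨rfl, he, rfl⟩ := h
      obtain rfl := eq_of_heq he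
      rcases hB with (⟨h'⟩ | ⟨h', s, hB⟩)
      · obtain rfl : s = j := by simpa [P] using h'
        simp
      · simp [P] at h'

theorem Impl.measure {T : ℓ → Set (Op ι)} (O : Σ k, Observable k) (hO : O ∈ F)
    (e : Fin O.1 ↪ ι) (h : ∀ s, Impl F fun j => {B | B * outcomeProj O.2 e s ∈ T j}) :
    Impl F T :=
  (Impl.measure_outcome O hO e).bind fun s => (h s).mono fun j B hB A hA => by
    obtain rfl : A = _ := hA
    exact hB

/-! ### Repeating until success -/

/-- The failing round: the O' term vanishes between equal spectral projections of O, so the state is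
only rescaled. -/
theorem specProj_conj_eq {O O' : Op ι} (hO : O * O = 1) (hOO' : O' * O = -(O * O'))
    (t r : Bool) : specProj O t * specProj O' r * specProj O t = (1 / 2 : ℂ) • specProj O t := by
  have h : O * O' * O = -O' := by rw [mul_assoc, hOO', mul_neg, ← mul_assoc, hO, one_mul]
  cases t <;> cases r <;>
  · simp only [specProj, Bool.false_eq_true, if_true, if_false, one_smul, neg_smul, smul_mul_assoc,
      mul_smul_comm, mul_add, add_mul, mul_one, one_mul, mul_neg, neg_mul, h, hO, hOO']
    module

/-- The successful round: between opposite spectral projections only the O' term survives, so O' has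
been applied. -/
theorem specProj_conj_ne {O O' : Op ι} (hO : O * O = 1) (hOO' : O' * O = -(O * O'))
    (t r : Bool) : specProj O (!t) * specProj O' r * specProj O t =
      ((if r then 1 else -1) * (1 / 2) : ℂ) • (O' * specProj O t) := by
  have h : O * O' * O = -O' := by rw [mul_assoc, hOO', mul_neg, ← mul_assoc, hO, one_mul]
  cases t <;> cases r <;>
  · simp only [specProj, Bool.false_eq_true, if_true, if_false, one_smul, neg_smul, smul_mul_assoc,
      mul_smul_comm, mul_add, add_mul, mul_one, one_mul, mul_neg, neg_mul, h, hO, hOO',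
      Bool.not_true, Bool.not_false]
    module

theorem specProj_mul_self {O : Op ι} (hO : O * O = 1) (t : Bool) :
    specProj O t * specProj O t = specProj O t := by
  cases t <;>
  · simp only [specProj, Bool.false_eq_true, if_true, if_false, one_smul, neg_smul, smul_mul_assoc,
      mul_smul_comm, mul_add, add_mul, mul_one, one_mul, mul_neg, neg_mul, hO]
    module

/-- Measure `O`; then measure `O'` and `O` alternately until the outcome of `O` changes. -/
def flipProgram (O O' : Σ k, Observable k) (hO : O ∈ F) (hO' : O' ∈ F) (e : Fin O.1 ↪ ι)
    (e' : Fin O'.1 ↪ ι) : Program F ι Unit where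
  Q := Fin 4 × Bool
  finite := inferInstance
  start := (0, true)
  instr
    | (0, _) => .measure O hO e fun t => (1, t)
    | (1, t) => .measure O' hO' e' fun _ => (2, t)
    | (2, t) => .measure O hO e fun t' => if t' = t then (1, t) else (3, t)
    | (3, _) => .halt ()

section Flip

variable (O O' : Σ k, Observable k) (hO : O ∈ F) (hO' : O' ∈ F) (e : Fin O.1 ↪ ι)
    (e' : Fin O'.1 ↪ ι)

theorem outcomeProj_conj_eq
    (hOO' : onQubits e' O'.2.mat * onQubits e O.2.mat
      = -(onQubits e O.2.mat * onQubits e' O'.2.mat)) (t r : Bool) :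
    outcomeProj O.2 e t * outcomeProj O'.2 e' r * outcomeProj O.2 e t
      = (1 / 2 : ℂ) • outcomeProj O.2 e t :=
  specProj_conj_eq (onQubits_mat_mul_self _ _) hOO' t r

theorem flipProgram_runningProb_le
    (hOO' : onQubits e' O'.2.mat * onQubits e O.2.mat
      = -(onQubits e O.2.mat * onQubits e' O'.2.mat)) (n : ℕ) (t : Bool) (ψ : Vec ι)
    (hψ : outcomeProj O.2 e t *ᵥ ψ = ψ) :
    (flipProgram O O' hO hO' e e').runningProb (n * 2) ((1, t) : Fin 4 × Bool) ψ
      ≤ (1 / 2) ^ n * normSq ψ := by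
  set P := flipProgram O O' hO hO' e e'
  induction n generalizing ψ with
  | zero =>
    rw [pow_zero, one_mul]
    exact P.runningProb_le_normSq _ _ _
  | succ n ih =>
    rw [Nat.succ_mul, P.runningProb_succ_of_measure (q := ((1, t) : Fin 4 × Bool)) rfl]
    -- For each outcome `r` of O' the failing branch leaves ψ/2, of squared norm 1/4; the two values
    -- of `r` make one round of two measurements fail with probability 1/2.
    have key : ∀ r, P.runningProb (n * 2 + 1) ((2, t) : Fin 4 × Bool)
        (outcomeProj O'.2 e' r *ᵥ ψ) ≤ (1 / 2) ^ n * (1 / 4 * normSq ψ) := by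
      intro r
      rw [P.runningProb_succ_of_measure (q := ((2, t) : Fin 4 × Bool)) rfl,
        ← Finset.sum_subset (Finset.subset_univ {t}), Finset.sum_singleton]
      · have hq := congrArg (fun q : Fin 4 × Bool => P.runningProb (n * 2) q ((1 / 2 : ℂ) • ψ))
          (if_pos rfl : (if t = t then ((1, t) : Fin 4 × Bool) else (3, t)) = (1, t))
        have hv : outcomeProj O.2 e t *ᵥ (outcomeProj O'.2 e' r *ᵥ ψ) = (1 / 2 : ℂ) • ψ := by
          conv_lhs => rw [← hψ]
          rw [Matrix.mulVec_mulVec, Matrix.mulVec_mulVec,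
            outcomeProj_conj_eq O O' e e' hOO', Matrix.smul_mulVec, hψ]
        rw [hv]
        refine hq.le.trans (le_of_le_of_eq (ih ((1 / 2 : ℂ) • ψ) ?_) ?_)
        · rw [Matrix.mulVec_smul, hψ]
        · rw [normSq_smul]
          norm_num
      · intro s _ hs
        refine P.runningProb_of_halt (k := ()) ?_ _ _
        rw [Finset.mem_singleton] at hs
        exact congrArg (fun q : Fin 4 × Bool => P.instr q)
          (if_neg hs : (if s = t then ((1, t) : Fin 4 × Bool) else (3, t)) = (3, t))
    calc _ ≤ ∑ _r : Bool, (1 / 2) ^ n * (1 / 4 * normSq ψ) :=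
          Finset.sum_le_sum fun r _ => key r
      _ = _ := by rw [Fintype.sum_bool, pow_succ]; ring

theorem flipProgram_terminates
    (hOO' : onQubits e' O'.2.mat * onQubits e O.2.mat
      = -(onQubits e O.2.mat * onQubits e' O'.2.mat)) :
    (flipProgram O O' hO hO' e e').Terminates := by
  intro ε hε
  obtain ⟨n, hn⟩ := exists_pow_lt_of_lt_one hε (by norm_num : (1 / 2 : ℝ) < 1)
  refine ⟨n * 2 + 1, fun ψ => ?_⟩
  rw [Program.runningProb_succ_of_measure _ (q := (flipProgram O O' hO hO' e e').start) rfl,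
    ← normSq_outcomeProj_add O.2 e ψ, Finset.mul_sum]
  refine Finset.sum_le_sum fun t _ => ?_
  refine (flipProgram_runningProb_le O O' hO hO' e e' hOO' n t _ ?_).trans
    (mul_le_mul_of_nonneg_right hn.le (normSq_nonneg _))
  rw [Matrix.mulVec_mulVec]
  exact congrArg (· *ᵥ ψ) (specProj_mul_self (onQubits_mat_mul_self _ _) t)

/-- One invariant per control location, proved together because locations 1 and 2 form the loop. At
these locations the rest of the run is controlled only after the projection for outcome `t` of O,
which has just been, or was before O', recorded. -/
theorem flipProgram_haltsWith
    (hOO' : onQubits e' O'.2.mat * onQubits e O.2.mat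
      = -(onQubits e O.2.mat * onQubits e' O'.2.mat)) {q : (flipProgram O O' hO hO' e e').Q}
    {u : Unit} {B : Op ι} (h : (flipProgram O O' hO hO' e e').HaltsWith q u B) (t : Bool) :
    (q = ((0, t) : Fin 4 × Bool) →
      ∃ (c : ℂ) (s : Bool), B = c • (onQubits e' O'.2.mat * outcomeProj O.2 e s)) ∧
    (q = ((1, t) : Fin 4 × Bool) → ∃ c : ℂ, B * outcomeProj O.2 e t
      = c • (onQubits e' O'.2.mat * outcomeProj O.2 e t)) ∧
    (q = ((2, t) : Fin 4 × Bool) → ∀ r, ∃ c : ℂ, B * outcomeProj O'.2 e' r * outcomeProj O.2 e t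
      = c • (onQubits e' O'.2.mat * outcomeProj O.2 e t)) ∧
    (q = ((3, t) : Fin 4 × Bool) → B = 1) := by
  induction h generalizing t with
  | @halt q u h =>
    refine ⟨?_, ?_, ?_, fun _ => rfl⟩ <;>
    · rintro rfl
      simp [flipProgram] at h
  | @measure q O₁ hO₁ e₁ next h s u B hB ih =>
    refine ⟨?_, ?_, ?_, ?_⟩ <;> rintro rfl
    · obtain ⟨rfl, he, rfl⟩ := Instr.measure.inj h
      obtain rfl := eq_of_heq he
      obtain ⟨c, hc⟩ := (ih s).2.1 rfl
      exact ⟨c, s, hc⟩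
    · obtain ⟨rfl, he, rfl⟩ := Instr.measure.inj h
      obtain rfl := eq_of_heq he
      exact (ih t).2.2.1 rfl s
    · obtain ⟨rfl, he, rfl⟩ := Instr.measure.inj h
      obtain rfl := eq_of_heq he
      intro r
      by_cases hs : s = t
      · subst hs
        obtain ⟨c, hc⟩ := (ih s).2.1 (if_pos rfl)
        refine ⟨1 / 2 * c, ?_⟩
        rw [mul_assoc, mul_assoc, ← mul_assoc (outcomeProj O.2 e s),
          outcomeProj_conj_eq O O' e e' hOO', mul_smul_comm, hc, smul_smul]
      · obtain rfl : B = 1 := (ih t).2.2.2 (if_neg hs)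
        obtain rfl : s = !t := by cases s <;> cases t <;> simp_all
        rw [one_mul]
        exact ⟨_, specProj_conj_ne (onQubits_mat_mul_self _ _) hOO' t r⟩
    · simp [flipProgram] at h

theorem Impl.flip (hO : O ∈ F) (hO' : O' ∈ F)
    (hOO' : onQubits e' O'.2.mat * onQubits e O.2.mat
      = -(onQubits e O.2.mat * onQubits e' O'.2.mat)) :
    Impl F fun _ : Unit =>
      {B | ∃ (c : ℂ) (t : Bool), B = c • (onQubits e' O'.2.mat * outcomeProj O.2 e t)} :=
  ⟨flipProgram O O' hO hO' e e', flipProgram_terminates O O' hO hO' e e' hOO', fun _ _ hB =>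
    (flipProgram_haltsWith O O' hO hO' e e' hOO' hB true).1 rfl⟩

end Flip

end Calculus

/-! ### One-qubit operators -/

section Loc

variable {ι : Type} [Fintype ι] [DecidableEq ι]

/-- The one-qubit operator `M` acting on the qubit `q` of a register. -/
def loc (q : ι) (M : Matrix (Fin 2) (Fin 2) ℂ) : Op ι :=
  fun x y => if ∀ i, i ≠ q → x i = y i then M (x q) (y q) else 0

theorem loc_mulVec_apply (q : ι) (M : Matrix (Fin 2) (Fin 2) ℂ) (v : Vec ι) (x : ι → Fin 2) :
    (loc q M *ᵥ v) x = ∑ b, M (x q) b * v (Function.update x q b) := by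
  have hinj : Function.Injective (Function.update x q) := Function.update_injective x q
  rw [Matrix.mulVec, dotProduct,
    ← Finset.sum_subset (Finset.subset_univ (Finset.univ.image (Function.update x q))),
    Finset.sum_image hinj.injOn]
  · refine Finset.sum_congr rfl fun b _ => ?_
    rw [loc, if_pos fun i hi => (Function.update_of_ne hi _ _).symm, Function.update_self]
  · intro y _ hy
    rw [loc, if_neg, zero_mul]
    refine fun h => hy (Finset.mem_image.2 ⟨y q, Finset.mem_univ _, funext fun i => ?_⟩)
    by_cases hi : i = q
    · subst hi; simp
    · rw [Function.update_of_ne hi, h i hi]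

theorem loc_mul_apply (q : ι) (M : Matrix (Fin 2) (Fin 2) ℂ) (A : Op ι) (x y : ι → Fin 2) :
    (loc q M * A) x y = ∑ b, M (x q) b * A (Function.update x q b) y :=
  loc_mulVec_apply q M (fun z => A z y) x

theorem loc_one (q : ι) : loc q 1 = 1 := by
  refine Matrix.ext fun x y => ?_
  rw [← mul_one (loc q 1), loc_mul_apply, Finset.sum_eq_single (x q)]
  · rw [Matrix.one_apply_eq, one_mul, Function.update_eq_self]
  · intro b _ hb
    rw [Matrix.one_apply_ne' hb, zero_mul]
  · simp

theorem loc_mul (q : ι) (M N : Matrix (Fin 2) (Fin 2) ℂ) : loc q M * loc q N = loc q (M * N) := by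
  refine Matrix.ext fun x y => ?_
  rw [loc_mul_apply]
  have : ∀ b, (∀ i, i ≠ q → Function.update x q b i = y i) ↔ ∀ i, i ≠ q → x i = y i :=
    fun b => forall₂_congr fun i hi => by rw [Function.update_of_ne hi]
  simp only [loc, this, Function.update_self, Matrix.mul_apply]
  split_ifs <;> simp

theorem loc_add (q : ι) (M N : Matrix (Fin 2) (Fin 2) ℂ) : loc q (M + N) = loc q M + loc q N := by
  refine Matrix.ext fun x y => ?_
  simp only [loc, Matrix.add_apply]
  split_ifs <;> simp

theorem loc_smul (q : ι) (c : ℂ) (M : Matrix (Fin 2) (Fin 2) ℂ) :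
    loc q (c • M) = c • loc q M := by
  refine Matrix.ext fun x y => ?_
  simp only [loc, Matrix.smul_apply]
  split_ifs <;> simp

theorem loc_neg (q : ι) (M : Matrix (Fin 2) (Fin 2) ℂ) : loc q (-M) = -loc q M := by
  rw [← neg_one_smul ℂ M, loc_smul, neg_one_smul]

theorem loc_conjTranspose (q : ι) (M : Matrix (Fin 2) (Fin 2) ℂ) : (loc q M)ᴴ = loc q Mᴴ := by
  refine Matrix.ext fun x y => ?_
  have : (∀ i, i ≠ q → y i = x i) ↔ ∀ i, i ≠ q → x i = y i :=
    forall₂_congr fun i _ => eq_comm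
  simp only [loc, Matrix.conjTranspose_apply, this]
  split_ifs <;> simp

theorem loc_mul_loc_apply {p q : ι} (hpq : p ≠ q) (M N : Matrix (Fin 2) (Fin 2) ℂ)
    (x y : ι → Fin 2) : (loc p M * loc q N) x y =
      if ∀ i, i ≠ p → i ≠ q → x i = y i then M (x p) (y p) * N (x q) (y q) else 0 := by
  rw [loc_mul_apply, Finset.sum_eq_single (y p)]
  · have : (∀ i, i ≠ q → Function.update x p (y p) i = y i) ↔
        ∀ i, i ≠ p → i ≠ q → x i = y i := by
      refine ⟨fun h i hp hq => ?_, fun h i hq => ?_⟩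
      · simpa [hp] using h i hq
      · by_cases hp : i = p
        · subst hp; simp
        · simpa [hp] using h i hp hq
    simp only [loc, this, Function.update_of_ne hpq.symm]
    split_ifs <;> simp
  · intro b _ hb
    rw [loc, if_neg, mul_zero]
    exact fun h => hb (by simpa using h p hpq)
  · simp

theorem loc_comm {p q : ι} (hpq : p ≠ q) (M N : Matrix (Fin 2) (Fin 2) ℂ) :
    loc p M * loc q N = loc q N * loc p M := by
  refine Matrix.ext fun x y => ?_
  rw [loc_mul_loc_apply hpq, loc_mul_loc_apply hpq.symm, mul_comm]
  exact if_congr ⟨fun h i h₁ h₂ => h i h₂ h₁, fun h i h₁ h₂ => h i h₂ h₁⟩ rfl rfl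

theorem onQubits_tensorOp_one (e : Fin 1 ↪ ι) (M : Matrix (Fin 2) (Fin 2) ℂ) :
    onQubits e (tensorOp fun _ => M) = loc (e 0) M := by
  refine Matrix.ext fun x y => ?_
  have : (∀ i, i ∉ Set.range e → x i = y i) ↔ ∀ i, i ≠ e 0 → x i = y i :=
    forall_congr' fun i => by simp [Fin.exists_fin_one, eq_comm]
  simp only [onQubits, loc, tensorOp, Fintype.prod_subsingleton _ (0 : Fin 1), this]

theorem onQubits_tensorOp_two (e : Fin 2 ↪ ι) (M N : Matrix (Fin 2) (Fin 2) ℂ) :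
    onQubits e (tensorOp ![M, N]) = loc (e 0) M * loc (e 1) N := by
  refine Matrix.ext fun x y => ?_
  rw [loc_mul_loc_apply fun h => by simpa using e.injective h]
  have : (∀ i, i ∉ Set.range e → x i = y i) ↔ ∀ i, i ≠ e 0 → i ≠ e 1 → x i = y i :=
    forall_congr' fun i => by simp [Fin.exists_fin_two, eq_comm]
  simp only [onQubits, tensorOp, Fin.prod_univ_two, Matrix.cons_val_zero, Matrix.cons_val_one, this]

end Loc

/-! ### Tensor products of operators -/

section Tensor

variable {ι κ R : Type} [Fintype ι] [DecidableEq ι] [Fintype κ] [DecidableEq κ] [Fintype R]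
  [DecidableEq R]

/-- The operator `A ⊗ B` on a register which is split into two parts by `σ`. -/
def ten (σ : ι ⊕ κ ≃ R) (A : Op ι) (B : Op κ) : Op R :=
  fun x y => A (fun i => x (σ (.inl i))) (fun i => y (σ (.inl i))) *
    B (fun j => x (σ (.inr j))) (fun j => y (σ (.inr j)))

variable (σ : ι ⊕ κ ≃ R)

/-- Basis states of a register as pairs of basis states of its two parts. -/
def splitBasis : (R → Fin 2) ≃ (ι → Fin 2) × (κ → Fin 2) :=
  (σ.arrowCongr (Equiv.refl _)).symm.trans (Equiv.sumArrowEquivProdArrow _ _ _)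

theorem ten_eq_submatrix (A : Op ι) (B : Op κ) :
    ten σ A B = (Matrix.kroneckerMap (· * ·) A B).submatrix (splitBasis σ) (splitBasis σ) := rfl

theorem ten_mul (A A' : Op ι) (B B' : Op κ) :
    ten σ A B * ten σ A' B' = ten σ (A * A') (B * B') := by
  rw [ten_eq_submatrix, ten_eq_submatrix, ten_eq_submatrix, Matrix.submatrix_mul_equiv,
    Matrix.mul_kronecker_mul]

theorem ten_one_one : ten σ 1 1 = 1 := by
  rw [ten_eq_submatrix, Matrix.one_kronecker_one, Matrix.submatrix_one_equiv]

theorem ten_add_left (A A' : Op ι) (B : Op κ) : ten σ (A + A') B = ten σ A B + ten σ A' B := by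
  ext x y; simp [ten, add_mul]

theorem ten_add_right (A : Op ι) (B B' : Op κ) : ten σ A (B + B') = ten σ A B + ten σ A B' := by
  ext x y; simp [ten, mul_add]

theorem ten_smul_left (c : ℂ) (A : Op ι) (B : Op κ) : ten σ (c • A) B = c • ten σ A B := by
  ext x y; simp [ten, mul_assoc]

theorem ten_smul_right (c : ℂ) (A : Op ι) (B : Op κ) : ten σ A (c • B) = c • ten σ A B := by
  ext x y; simp [ten, mul_left_comm]

theorem ten_conjTranspose (A : Op ι) (B : Op κ) : (ten σ A B)ᴴ = ten σ Aᴴ Bᴴ := by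
  ext x y; simp [ten]

theorem loc_inl (q : ι) (M : Matrix (Fin 2) (Fin 2) ℂ) :
    loc (σ (.inl q)) M = ten σ (loc q M) 1 := by
  refine Matrix.ext fun x y => ?_
  have : (∀ i, i ≠ σ (.inl q) → x i = y i) ↔ (∀ i, i ≠ q → x (σ (.inl i)) = y (σ (.inl i))) ∧
      (fun j => x (σ (.inr j))) = (fun j => y (σ (.inr j))) := by
    rw [← σ.forall_congr_right (q := fun i => i ≠ σ (.inl q) → x i = y i), Sum.forall, funext_iff]
    simp
  simp only [loc, ten, this, Matrix.one_apply]
  split_ifs <;> simp_all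

theorem loc_inr (q : κ) (M : Matrix (Fin 2) (Fin 2) ℂ) :
    loc (σ (.inr q)) M = ten σ 1 (loc q M) := by
  refine Matrix.ext fun x y => ?_
  have : (∀ i, i ≠ σ (.inr q) → x i = y i) ↔
      (fun j => x (σ (.inl j))) = (fun j => y (σ (.inl j))) ∧
      (∀ i, i ≠ q → x (σ (.inr i)) = y (σ (.inr i))) := by
    rw [← σ.forall_congr_right (q := fun i => i ≠ σ (.inr q) → x i = y i), Sum.forall, funext_iff]
    simp
  simp only [loc, ten, this, Matrix.one_apply]
  split_ifs <;> simp_all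

theorem ten_mulVec_tensorVec (A : Op ι) (B : Op κ) (φ : Vec ι) (χ : Vec κ) :
    ten (Equiv.refl _) A B *ᵥ tensorVec φ χ = tensorVec (A *ᵥ φ) (B *ᵥ χ) := by
  ext x
  simp only [Matrix.mulVec, dotProduct, tensorVec, ten, Finset.sum_mul_sum, Equiv.refl_apply]
  rw [← Fintype.sum_prod_type', ← (splitBasis (Equiv.refl (ι ⊕ κ))).sum_comp]
  refine Finset.sum_congr rfl fun y _ => ?_
  simp only [splitBasis, Equiv.trans_apply, Equiv.sumArrowEquivProdArrow]
  exact mul_mul_mul_comm _ _ _ _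

end Tensor

/-! ### Measuring the observables of the family -/

section Measure

variable {R ℓ : Type} [Fintype R] [DecidableEq R] {T : ℓ → Set (Op R)}

theorem Impl.measure_ZX {p q : R} (hpq : p ≠ q)
    (h : ∀ s, Impl F2 fun j => {B | B * specProj (loc p pauliZ * loc q pauliX) s ∈ T j}) :
    Impl F2 T := by
  let e : Fin 2 ↪ R := ⟨![p, q], by
    intro i j h
    fin_cases i <;> fin_cases j <;> simp_all [eq_comm]⟩
  refine Impl.measure ⟨2, obsZX⟩ (by simp [F2]) e fun s => (h s).mono fun j B hB => ?_
  have : onQubits e obsZX.mat = loc p pauliZ * loc q pauliX := onQubits_tensorOp_two e _ _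
  change B * specProj (onQubits e obsZX.mat) s ∈ T j
  rw [this]
  exact hB

theorem Impl.measure_Z (q : R)
    (h : ∀ s, Impl F2 fun j => {B | B * specProj (loc q pauliZ) s ∈ T j}) : Impl F2 T := by
  let e : Fin 1 ↪ R := ⟨fun _ => q, fun i j _ => Subsingleton.elim i j⟩
  refine Impl.measure ⟨1, obsZ⟩ (by simp [F2]) e fun s => (h s).mono fun j B hB => ?_
  have : onQubits e obsZ.mat = loc q pauliZ := onQubits_tensorOp_one e _
  change B * specProj (onQubits e obsZ.mat) s ∈ T j
  rw [this]
  exact hB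

theorem Impl.measure_planar (q : R) {θ : ℝ} (hθ : θ ∈ Set.Icc 0 (2 * Real.pi))
    (h : ∀ s, Impl F2 fun j => {B | B * specProj (loc q (planar θ)) s ∈ T j}) : Impl F2 T := by
  let e : Fin 1 ↪ R := ⟨fun _ => q, fun i j _ => Subsingleton.elim i j⟩
  refine Impl.measure ⟨1, obsPlanar θ⟩ (.inr ⟨θ, hθ, rfl⟩) e fun s => (h s).mono fun j B hB => ?_
  have : onQubits e (obsPlanar θ).mat = loc q (planar θ) := onQubits_tensorOp_one e _
  change B * specProj (onQubits e (obsPlanar θ).mat) s ∈ T j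
  rw [this]
  exact hB

theorem Impl.flip_ZX {p q r : R} (hpq : p ≠ q) {θ : ℝ} (hθ : θ ∈ Set.Icc 0 (2 * Real.pi))
    (h : loc p pauliZ * loc q pauliX * loc r (planar θ) =
      -(loc r (planar θ) * (loc p pauliZ * loc q pauliX))) :
    Impl F2 fun _ : Unit => {B : Op R | ∃ (c : ℂ) (t : Bool),
      B = c • (loc p pauliZ * loc q pauliX * specProj (loc r (planar θ)) t)} := by
  let e : Fin 1 ↪ R := ⟨fun _ => r, fun i j _ => Subsingleton.elim i j⟩
  let e' : Fin 2 ↪ R := ⟨![p, q], by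
    intro i j h
    fin_cases i <;> fin_cases j <;> simp_all [eq_comm]⟩
  have h₁ : onQubits e (obsPlanar θ).mat = loc r (planar θ) := onQubits_tensorOp_one e _
  have h₂ : onQubits e' obsZX.mat = loc p pauliZ * loc q pauliX := onQubits_tensorOp_two e' _ _
  have := Impl.flip (F := F2) ⟨1, obsPlanar θ⟩ ⟨2, obsZX⟩ e e' (.inr ⟨θ, hθ, rfl⟩) (by simp [F2])
    (by simpa only [h₁, h₂] using h)
  simp only [h₂] at this
  refine this.mono ?_
  rintro _ B ⟨c, t, rfl⟩
  refine ⟨c, t, ?_⟩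
  rw [← h₁]
  rfl

end Measure

/-! ### Products of projections with one auxiliary qubit -/

section Algebra

/-- The eigenvalue that belongs to an outcome. -/
def sgn (s : Bool) : ℂ := if s then 1 else -1

theorem sgn_mul (s t : Bool) : sgn s * sgn t = sgn (s == t) := by
  cases s <;> cases t <;> simp [sgn]

variable {ι κ R : Type} [Fintype ι] [DecidableEq ι] [Fintype κ] [DecidableEq κ] [Fintype R]
  [DecidableEq R]

theorem specProj_eq (O : Op ι) (s : Bool) : specProj O s = (1 / 2 : ℂ) • (1 + sgn s • O) := rfl

theorem specProj_mul {O : Op ι} (hO : O * O = 1) (s : Bool) :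
    specProj O s * O = sgn s • specProj O s := by
  cases s <;> simp [specProj_eq, sgn, add_mul, hO, add_comm]

theorem mul_specProj {O : Op ι} (hO : O * O = 1) (s : Bool) :
    O * specProj O s = sgn s • specProj O s := by
  cases s <;> simp [specProj_eq, sgn, mul_add, hO, add_comm]

variable (σ : ι ⊕ κ ≃ R)

theorem specProj_ten_one_left (O : Op κ) (s : Bool) :
    specProj (ten σ 1 O) s = ten σ 1 (specProj O s) := by
  rw [specProj_eq, specProj_eq, ten_smul_right, ten_add_right, ten_smul_right, ten_one_one]

theorem specProj_ten_one_right (O : Op ι) (s : Bool) :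
    specProj (ten σ O 1) s = ten σ (specProj O s) 1 := by
  rw [specProj_eq, specProj_eq, ten_smul_left, ten_add_left, ten_smul_left, ten_one_one]

/-- Between an eigenprojection of O and one of O', the operator O·O' is the product of two
eigenvalues, so the measurement of A ⊗ N turns into a polynomial in A alone. -/
theorem sandwich_ten {O O' : Op κ} (hO : O * O = 1) (hO' : O' * O' = 1) (N : Op κ) (c : ℂ)
    (hN : N = c • (O * O')) (A : Op ι) (t r w : Bool) :
    ten σ 1 (specProj O t) * specProj (ten σ A N) r * ten σ 1 (specProj O' w) =
      ten σ ((1 / 2 : ℂ) • (1 + (c * sgn r * sgn t * sgn w) • A))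
        (specProj O t * specProj O' w) := by
  have h : specProj O t * N * specProj O' w
      = (c * sgn t * sgn w) • (specProj O t * specProj O' w) := by
    rw [hN, mul_smul_comm, ← mul_assoc, specProj_mul hO, smul_mul_assoc, smul_mul_assoc,
      smul_mul_assoc, mul_assoc, mul_specProj hO', mul_smul_comm, smul_smul, smul_smul]
  simp only [specProj_eq (ten σ A N), ← ten_one_one σ, mul_smul_comm, smul_mul_assoc, mul_add,
    add_mul, ten_mul, one_mul, mul_one, h, ten_smul_left, ten_smul_right, ten_add_left]
  module

/-- On the auxiliary factor O and O' become eigenvalues at the outer projections. In the cross term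
they stand in the wrong order, and anticommutation produces the minus sign; this sign makes the
result of CNOT type. -/
theorem sandwich_ten_mul_ten {O O' : Op κ} (hO : O * O = 1) (hO' : O' * O' = 1)
    (hOO' : O' * O = -(O * O')) (A M B : Op ι) (t s r w : Bool) :
    ten σ 1 (specProj O t) * specProj (ten σ A O') s * ten σ M 1 * specProj (ten σ B O) r *
      ten σ 1 (specProj O' w) =
    ten σ ((1 / 4 : ℂ) • (M + (sgn s * sgn w) • (A * M) + (sgn r * sgn t) • (M * B) -
        (sgn s * sgn w * (sgn r * sgn t)) • (A * M * B)))
      (specProj O t * specProj O' w) := by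
  have h₁ : specProj O t * O' * specProj O' w = sgn w • (specProj O t * specProj O' w) := by
    rw [mul_assoc, mul_specProj hO', mul_smul_comm]
  have h₂ : specProj O t * O * specProj O' w = sgn t • (specProj O t * specProj O' w) := by
    rw [specProj_mul hO, smul_mul_assoc]
  have h₃ : specProj O t * O' * O * specProj O' w
      = -(sgn t * sgn w) • (specProj O t * specProj O' w) := by
    rw [mul_assoc (specProj O t), hOO', mul_neg, neg_mul, ← mul_assoc, specProj_mul hO,
      smul_mul_assoc, smul_mul_assoc, mul_assoc, mul_specProj hO', mul_smul_comm, smul_smul,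
      neg_smul]
  simp only [specProj_eq (ten σ A O'), specProj_eq (ten σ B O), ← ten_one_one σ, mul_smul_comm,
    smul_mul_assoc, mul_add, add_mul, smul_add, ten_mul, one_mul, mul_one, h₁, h₂, h₃,
    ten_smul_right, sub_eq_add_neg, ← neg_smul, ten_smul_left, ten_add_left]
  module

end Algebra

/-! ### Simulating gates with one auxiliary qubit -/

section Gates

variable {ι R : Type} [Fintype ι] [DecidableEq ι] [Fintype R] [DecidableEq R]
  (σ : ι ⊕ Fin 1 ≃ R)

/-- Some program on the register `R`, whose last qubit is auxiliary, performs the operator `U` on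
the other qubits, in product with some operator on the auxiliary qubit. -/
def Sim (U : Op ι) : Prop := Impl F2 fun _ : Unit => {B : Op R | ∃ K, B = ten σ U K}

variable {σ}

theorem Sim.mul {U V : Op ι} (hU : Sim σ U) (hV : Sim σ V) : Sim σ (U * V) :=
  Impl.bind hV fun _ => hU.mono fun _ B hB A hA => by
    obtain ⟨K, rfl⟩ := hB
    obtain ⟨K', rfl⟩ := hA
    exact ⟨K * K', ten_mul ..⟩

/-- Scalars move into the operator on the auxiliary qubit, so normalizations and global phases are
free. -/
theorem Sim.smul {U : Op ι} (hU : Sim σ U) {c : ℂ} (hc : c ≠ 0) : Sim σ (c • U) :=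
  hU.mono fun _ B hB => by
    obtain ⟨K, rfl⟩ := hB
    exact ⟨c⁻¹ • K, by rw [ten_smul_left, ten_smul_right, smul_smul, mul_inv_cancel₀ hc, one_smul]⟩

theorem Sim.one : Sim σ 1 := Impl.halt () ⟨1, (ten_one_one σ).symm⟩

theorem zero_mem_Icc_two_pi : (0 : ℝ) ∈ Set.Icc 0 (2 * Real.pi) :=
  ⟨le_rfl, by positivity⟩

theorem pi_div_two_mem_Icc_two_pi : Real.pi / 2 ∈ Set.Icc 0 (2 * Real.pi) :=
  ⟨by positivity, by linarith [Real.pi_pos]⟩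

theorem planar_zero : planar 0 = pauliX := by simp [planar]

theorem planar_pi_div_two : planar (Real.pi / 2) = pauliY := by simp [planar]

theorem pauliY_mul_self : pauliY * pauliY = 1 := by
  rw [← planar_pi_div_two, planar_mul_self]

theorem pauliX_mul_pauliY : pauliX * pauliY = -(pauliY * pauliX) := by
  ext i j; fin_cases i <;> fin_cases j <;> simp [pauliX, pauliY]

theorem pauliZ_mul_pauliX : pauliZ * pauliX = -(pauliX * pauliZ) := by
  ext i j; fin_cases i <;> fin_cases j <;> simp [pauliX, pauliZ]

theorem pauliZ_eq : pauliZ = Complex.I • (pauliY * pauliX) := by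
  ext i j; fin_cases i <;> fin_cases j <;> simp [pauliX, pauliY, pauliZ]

theorem loc_mul_self {M : Matrix (Fin 2) (Fin 2) ℂ} (hM : M * M = 1) (q : ι) :
    loc q M * loc q M = 1 := by
  rw [loc_mul, hM, loc_one]

theorem loc_inl_mul_loc_inr (q : ι) (M N : Matrix (Fin 2) (Fin 2) ℂ) :
    loc (σ (.inl q)) M * loc (σ (.inr 0)) N = ten σ (loc q M) (loc 0 N) := by
  rw [loc_inl, loc_inr, ten_mul, one_mul, mul_one]

theorem loc_inr_mul_loc_inl (q : ι) (M N : Matrix (Fin 2) (Fin 2) ℂ) :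
    loc (σ (.inr 0)) M * loc (σ (.inl q)) N = ten σ (loc q N) (loc 0 M) := by
  rw [loc_inl, loc_inr, ten_mul, one_mul, mul_one]

/-- Flip with O = Y on the auxiliary qubit and O' = Z ⊗ X, X being on that qubit: X and Y
anticommute there, and O' times a projection of Y factors. -/
theorem sim_pauliZ (q : ι) : Sim σ (loc q pauliZ) := by
  refine (Impl.flip_ZX (p := σ (.inl q)) (q := σ (.inr 0)) (r := σ (.inr 0)) (by simp)
    pi_div_two_mem_Icc_two_pi ?_).mono ?_
  · rw [mul_assoc, loc_mul, planar_pi_div_two, pauliX_mul_pauliY, loc_neg, ← loc_mul, mul_neg,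
      ← mul_assoc, loc_comm (by simp), mul_assoc]
  · rintro _ B ⟨c, t, rfl⟩
    rw [loc_inl_mul_loc_inr, loc_inr, specProj_ten_one_left, ten_mul, mul_one, ← ten_smul_right]
    exact ⟨_, rfl⟩

/-- The same flip with O = X and the Z of Z ⊗ X on the auxiliary qubit. -/
theorem sim_pauliX (q : ι) : Sim σ (loc q pauliX) := by
  refine (Impl.flip_ZX (p := σ (.inr 0)) (q := σ (.inl q)) (r := σ (.inr 0)) (by simp)
    zero_mem_Icc_two_pi ?_).mono ?_
  · rw [planar_zero, mul_assoc, loc_comm (by simp), ← mul_assoc, loc_mul, pauliZ_mul_pauliX,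
      loc_neg, neg_mul, ← loc_mul, mul_assoc]
  · rintro _ B ⟨c, t, rfl⟩
    rw [loc_inr_mul_loc_inl, loc_inr, specProj_ten_one_left, ten_mul, mul_one, ← ten_smul_right]
    exact ⟨_, rfl⟩

/-- Here `1 + i X` is `√2` times a unitary. -/
theorem sim_one_add_I_smul_pauliX (q : ι) : Sim σ (1 + Complex.I • loc q pauliX) := by
  have hX := loc_mul_self pauliX_mul_self q
  refine Impl.measure_planar (σ (.inr 0)) zero_mem_Icc_two_pi fun w => ?_
  refine Impl.measure_ZX (p := σ (.inr 0)) (q := σ (.inl q)) (by simp) fun r => ?_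
  refine Impl.measure_planar (σ (.inr 0)) pi_div_two_mem_Icc_two_pi fun t => ?_
  obtain ⟨C, c, hC, hc⟩ : ∃ (C : Op ι) (c : ℂ), Sim σ C ∧
      C * (1 + (Complex.I * sgn r * sgn t * sgn w) • loc q pauliX) =
        c • (1 + Complex.I • loc q pauliX) := by
    rw [mul_assoc, mul_assoc, sgn_mul, sgn_mul]
    -- The three outcomes enter only through the product of their signs. If it is negative, X(1 -
    -- iX) = -i(1 + iX) repairs the result.
    cases r == (t == w)
    · refine ⟨_, -Complex.I, sim_pauliX q, ?_⟩
      simp only [mul_add, mul_one, mul_smul_comm, hX, sgn, smul_add, smul_smul, neg_mul,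
        Complex.I_mul_I]
      simp [add_comm]
    · exact ⟨1, 1, Sim.one, by simp [sgn]⟩
  refine hC.mono ?_
  rintro _ B ⟨K, rfl⟩
  simp only [Set.mem_ofPred_eq, loc_inr_mul_loc_inl]
  simp only [loc_inr, specProj_ten_one_left, planar_zero, planar_pi_div_two]
  have hN : loc (0 : Fin 1) pauliZ
      = Complex.I • (loc 0 pauliY * loc 0 pauliX) := by
    rw [loc_mul, ← loc_smul, ← pauliZ_eq]
  rw [mul_assoc, mul_assoc, ← mul_assoc (ten σ 1 _), sandwich_ten σ (loc_mul_self pauliY_mul_self 0)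
    (loc_mul_self pauliX_mul_self 0) _ _ hN, ten_mul, mul_smul_comm, hc, smul_smul, ten_smul_left,
    ← ten_smul_right]
  exact ⟨_, rfl⟩

/-- The controlled `X` gate with control `q` and target `r`. -/
def cnot (q r : ι) : Op ι :=
  1 + loc r pauliX + loc q pauliZ - loc r pauliX * loc q pauliZ

/-- `cnot` is twice the unitary gate: on Z = 1 it is 2 and on Z = -1 it is 2X. It is the polynomial
of `sandwich_ten_mul_ten` with M = 1 when both sign products are positive. -/
theorem sim_cnot {q r : ι} (hqr : q ≠ r) : Sim σ (cnot q r) := by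
  have hX := loc_mul_self pauliX_mul_self r
  have hZ := loc_mul_self pauliZ_mul_self q
  have hXZ : loc q pauliZ * loc r pauliX = loc r pauliX * loc q pauliZ :=
    loc_comm hqr _ _
  have hXXZ : loc r pauliX * (loc r pauliX * loc q pauliZ)
      = loc q pauliZ := by rw [← mul_assoc, hX, one_mul]
  have hZXZ : loc q pauliZ * (loc r pauliX * loc q pauliZ)
      = loc r pauliX := by rw [← hXZ, ← mul_assoc, hZ, one_mul]
  refine Impl.measure_Z (σ (.inr 0)) fun w => ?_
  refine Impl.measure_ZX (p := σ (.inl q)) (q := σ (.inr 0)) (by simp) fun u => ?_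
  refine Impl.measure_ZX (p := σ (.inr 0)) (q := σ (.inl r)) (by simp) fun s => ?_
  refine Impl.measure_planar (σ (.inr 0)) zero_mem_Icc_two_pi fun t => ?_
  obtain ⟨C, c, hC, hc⟩ : ∃ (C : Op ι) (c : ℂ), Sim σ C ∧
      C * (1 + (sgn s * sgn w) • (loc r pauliX * 1) + (sgn u * sgn t) •
        (1 * loc q pauliZ) - (sgn s * sgn w * (sgn u * sgn t)) •
          (loc r pauliX * 1 * loc q pauliZ)) = c • cnot q r := by
    rw [sgn_mul, sgn_mul, mul_one, one_mul]
    -- A wrong sign of the X term is repaired by Z on `q`, a wrong sign of the Z term by X on `r`,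
    -- and both by the product, up to the scalar -1.
    cases s == w <;> cases u == t
    · refine ⟨_, -1, (sim_pauliX r).mul (sim_pauliZ q), ?_⟩
      simp only [sgn, cnot, mul_add, mul_sub, mul_one, mul_smul_comm, mul_assoc, hXZ, hZ, hX,
        hXXZ, hZXZ, Bool.false_eq_true, if_false]
      module
    · refine ⟨_, 1, sim_pauliZ q, ?_⟩
      simp only [sgn, cnot, mul_add, mul_sub, mul_one, mul_smul_comm, hXZ, hZ, hZXZ,
        Bool.false_eq_true, if_false, if_true]
      module
    · refine ⟨_, 1, sim_pauliX r, ?_⟩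
      simp only [sgn, cnot, mul_add, mul_sub, mul_one, mul_smul_comm, hX, hXXZ,
        Bool.false_eq_true, if_false, if_true]
      module
    · exact ⟨1, 1, Sim.one, by simp [sgn, cnot]⟩
  refine hC.mono ?_
  rintro _ B ⟨K, rfl⟩
  simp only [Set.mem_ofPred_eq, loc_inr_mul_loc_inl, loc_inl_mul_loc_inr]
  simp only [loc_inr, specProj_ten_one_left, planar_zero]
  have key := sandwich_ten_mul_ten σ (loc_mul_self pauliX_mul_self (0 : Fin 1))
    (loc_mul_self pauliZ_mul_self 0) (by rw [loc_mul, loc_mul, pauliZ_mul_pauliX, loc_neg])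
    (loc r pauliX) 1 (loc q pauliZ) t s u w
  rw [ten_one_one, mul_one] at key
  have hassoc : ∀ a b c d e : Op R, a * b * c * d * e = a * (b * c * d * e) := by
    intros; simp only [mul_assoc]
  rw [hassoc, key, ten_mul, mul_smul_comm, hc, smul_smul, ten_smul_left, ← ten_smul_right]
  exact ⟨_, rfl⟩

/-- The phase gate `diag (1, u)`. -/
def phase (u : ℂ) : Matrix (Fin 2) (Fin 2) ℂ := !![1, 0; 0, u]

theorem planar_eq (θ : ℝ) :
    planar θ = !![0, Complex.exp (-(θ * Complex.I)); Complex.exp (θ * Complex.I), 0] := by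
  rw [← neg_mul, Complex.exp_mul_I, Complex.exp_mul_I, Complex.cos_neg, Complex.sin_neg]
  ext i j
  fin_cases i <;> fin_cases j <;> simp [planar, pauliX, pauliY]

theorem specProj_loc (q : ι) (M : Matrix (Fin 2) (Fin 2) ℂ) (s : Bool) :
    specProj (loc q M) s = loc q ((1 / 2 : ℂ) • (1 + sgn s • M)) := by
  rw [specProj_eq, loc_smul, loc_add, loc_smul, loc_one]

/-- `M` has a single nonzero row, selected by `z`, whose entries differ by the phase `v` up to sign.
The combination equals M(1 + bZ) + aXM(1 - bZ): it keeps one column and moves the other to the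
opposite row. The result is diagonal or antidiagonal, hence a phase gate up to X and Z. -/
theorem exists_pauli_correction (u v : ℂ) (huv : u * v = 1) (j z a b : Bool)
    (M : Matrix (Fin 2) (Fin 2) ℂ) (hM : M = ((1 / 2 : ℂ) • (1 + sgn z • pauliZ)) *
      ((1 / 2 : ℂ) • (1 + sgn j • !![0, v; u, 0]))) :
    ∃ c : ℂ, (if b == z then 1 else pauliX) * (if a == j then 1 else pauliZ) *
      (M + sgn a • (pauliX * M) + sgn b • (M * pauliZ) -
        (sgn a * sgn b) • (pauliX * M * pauliZ)) = c • phase v := by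
  -- When `z` is the outcome -1 the nonzero row is proportional to (±u, 1), which is u·(±1, v)
  -- because u·v = 1.
  refine ⟨(if z then 1 else u) * (if a == j then 1 else sgn z) * (if b == z then 1 else sgn j), ?_⟩
  obtain rfl : M = (1 / 4 : ℂ) • !![1 + sgn z, (1 + sgn z) * sgn j * v;
      (1 - sgn z) * sgn j * u, 1 - sgn z] := by
    rw [hM]
    ext i k
    fin_cases i <;> fin_cases k <;> simp [pauliZ, Matrix.mul_apply] <;> ring
  cases j <;> cases z <;> cases a <;> cases b <;>
    simp only [sgn, pauliX, pauliZ, phase, Matrix.one_fin_two, Matrix.mul_fin_two, Matrix.smul_of,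
      Matrix.smul_cons, Matrix.smul_empty, smul_eq_mul, beq_self_eq_true, Bool.false_eq_true,
      if_true, if_false,
      Matrix.of_add_of, Matrix.of_sub_of, Matrix.add_cons, Matrix.sub_cons, Matrix.head_cons,
      Matrix.tail_cons, Matrix.empty_add_empty, Matrix.empty_sub_empty] <;>
    ext i k <;> fin_cases i <;> fin_cases k <;> simp [huv] <;> ring_nf

/-- The state is transferred from `q` to the auxiliary qubit by Z ⊗ X and a planar measurement of
`q`, which imprints the phase; after `q` is reset by measuring Z, the state is transferred back. -/
theorem sim_phase_of_mem (q : ι) {θ : ℝ} (hθ : θ ∈ Set.Icc 0 (2 * Real.pi)) :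
    Sim σ (loc q (phase (Complex.exp (-(θ * Complex.I))))) := by
  refine Impl.measure_Z (σ (.inr 0)) fun w => ?_
  refine Impl.measure_ZX (p := σ (.inl q)) (q := σ (.inr 0)) (by simp) fun r => ?_
  refine Impl.measure_planar (σ (.inl q)) hθ fun j => ?_
  refine Impl.measure_Z (σ (.inl q)) fun z => ?_
  refine Impl.measure_ZX (p := σ (.inr 0)) (q := σ (.inl q)) (by simp) fun s => ?_
  refine Impl.measure_planar (σ (.inr 0)) zero_mem_Icc_two_pi fun t => ?_
  set M := specProj (loc q pauliZ) z * specProj (loc q (planar θ)) j with hM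
  obtain ⟨C, c, hC, hc⟩ : ∃ (C : Op ι) (c : ℂ), Sim σ C ∧
      C * (M + (sgn s * sgn w) • (loc q pauliX * M) + (sgn r * sgn t) •
        (M * loc q pauliZ) - (sgn s * sgn w * (sgn r * sgn t)) •
          (loc q pauliX * M * loc q pauliZ)) =
      c • loc q (phase (Complex.exp (-(θ * Complex.I)))) := by
    obtain ⟨c, hc⟩ := exists_pauli_correction (Complex.exp (θ * Complex.I))
      (Complex.exp (-(θ * Complex.I))) (by rw [← Complex.exp_add, add_neg_cancel, Complex.exp_zero])
      j z (s == w) (r == t) _ rfl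
    rw [← planar_eq] at hc
    refine ⟨loc q (if (r == t) == z then 1 else pauliX) *
      loc q (if (s == w) == j then 1 else pauliZ), c, .mul ?_ ?_, ?_⟩
    · split_ifs
      · rw [loc_one]; exact Sim.one
      · exact sim_pauliX q
    · split_ifs
      · rw [loc_one]; exact Sim.one
      · exact sim_pauliZ q
    · rw [← loc_smul, ← hc, hM, specProj_loc, specProj_loc, sgn_mul, sgn_mul, sub_eq_add_neg,
        sub_eq_add_neg]
      simp only [loc_mul, ← loc_smul, ← loc_add, ← loc_neg]
  refine hC.mono ?_
  rintro _ B ⟨K, rfl⟩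
  simp only [Set.mem_ofPred_eq, loc_inr_mul_loc_inl, loc_inl_mul_loc_inr]
  simp only [loc_inr, loc_inl, specProj_ten_one_left, specProj_ten_one_right, planar_zero]
  have key := sandwich_ten_mul_ten σ (loc_mul_self pauliX_mul_self (0 : Fin 1))
    (loc_mul_self pauliZ_mul_self 0) (by rw [loc_mul, loc_mul, pauliZ_mul_pauliX, loc_neg])
    (loc q pauliX) M (loc q pauliZ) t s r w
  rw [hM, ← mul_one (1 : Op (Fin 1)), ← ten_mul, ← hM] at key
  have hassoc : ∀ a b c d e f g : Op R,
      a * b * c * d * e * f * g = a * (b * c * (d * e) * f * g) := by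
    intros; simp only [mul_assoc]
  rw [hassoc, key, ten_mul, mul_smul_comm, hc, smul_smul, ten_smul_left, ← ten_smul_right]
  exact ⟨_, rfl⟩

end Gates

/-! ### Exact universality of the gates -/

section Universality

variable {ι R : Type} [Fintype ι] [DecidableEq ι] [Fintype R] [DecidableEq R]
  (σ : ι ⊕ Fin 1 ≃ R)

/-- `U` is unitary, and both `U` and its inverse can be simulated. -/
structure Gate (U : Op ι) : Prop where
  conjTranspose_mul : Uᴴ * U = 1
  sim : Sim σ U
  sim_conjTranspose : Sim σ Uᴴ

variable {σ}

theorem Gate.mul_conjTranspose {U : Op ι} (hU : Gate σ U) : U * Uᴴ = 1 :=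
  mul_eq_one_comm.1 hU.conjTranspose_mul

theorem Gate.mul {U V : Op ι} (hU : Gate σ U) (hV : Gate σ V) : Gate σ (U * V) := by
  refine ⟨?_, hU.sim.mul hV.sim, ?_⟩
  · rw [Matrix.conjTranspose_mul, mul_assoc, ← mul_assoc Uᴴ, hU.conjTranspose_mul, one_mul,
      hV.conjTranspose_mul]
  · rw [Matrix.conjTranspose_mul]
    exact hV.sim_conjTranspose.mul hU.sim_conjTranspose

theorem Gate.conjTranspose {U : Op ι} (hU : Gate σ U) : Gate σ Uᴴ :=
  ⟨by rw [Matrix.conjTranspose_conjTranspose, hU.mul_conjTranspose], hU.sim_conjTranspose,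
    by rw [Matrix.conjTranspose_conjTranspose]; exact hU.sim⟩

theorem Gate.one : Gate σ 1 :=
  ⟨by simp, Sim.one, by rw [Matrix.conjTranspose_one]; exact Sim.one⟩

theorem Gate.smul {U : Op ι} (hU : Gate σ U) {c : ℂ} (hc : ‖c‖ = 1) : Gate σ (c • U) := by
  have hc0 : c ≠ 0 := by rintro rfl; simp at hc
  refine ⟨?_, hU.sim.smul hc0, ?_⟩
  · rw [Matrix.conjTranspose_smul, smul_mul_smul_comm, hU.conjTranspose_mul, Complex.star_def,
      Complex.conj_mul', hc]
    simp
  · rw [Matrix.conjTranspose_smul]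
    exact hU.sim_conjTranspose.smul (star_ne_zero.2 hc0)

theorem sim_phase (q : ι) {u : ℂ} (hu : ‖u‖ = 1) : Sim σ (loc q (phase u)) := by
  obtain ⟨θ, hθ, h⟩ : ∃ θ ∈ Set.Icc 0 (2 * Real.pi), Complex.exp (-(θ * Complex.I)) = u := by
    have harg : Complex.exp (u.arg * Complex.I) = u := by
      simpa [hu] using Complex.norm_mul_exp_arg_mul_I u
    have h₁ := Complex.neg_pi_lt_arg u
    have h₂ := Complex.arg_le_pi u
    -- `arg` lies in (-π, π], and the exponent carries a minus sign: -arg or 2π - arg falls in the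
    -- allowed interval.
    by_cases h : u.arg ≤ 0
    · refine ⟨-u.arg, ⟨by linarith, by linarith [Real.pi_pos]⟩, ?_⟩
      rw [Complex.ofReal_neg, neg_mul, neg_neg, harg]
    · refine ⟨2 * Real.pi - u.arg, ⟨by linarith, by linarith⟩, ?_⟩
      rw [← Complex.exp_periodic, ← harg]
      push_cast
      rw [harg]
      conv_rhs => rw [← harg]
      congr 1
      ring
  exact h ▸ sim_phase_of_mem q hθ

theorem phase_conjTranspose (u : ℂ) : (phase u)ᴴ = phase (star u) := by
  ext i j; fin_cases i <;> fin_cases j <;> simp [phase]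

theorem gate_phase (q : ι) {u : ℂ} (hu : ‖u‖ = 1) : Gate σ (loc q (phase u)) := by
  refine ⟨?_, sim_phase q hu, ?_⟩
  · rw [loc_conjTranspose, loc_mul, phase_conjTranspose, ← loc_one q]
    congr 1
    simp [phase, Matrix.one_fin_two, Complex.conj_mul', hu]
  · rw [loc_conjTranspose, phase_conjTranspose]
    exact sim_phase q (by simpa using hu)

/-! ### Action of the gates on amplitudes -/

/-- Invert the bit `q`. -/
def flipBit (q : ι) (x : ι → Fin 2) : ι → Fin 2 := Function.update x q (x q + 1)

theorem fin_two_eq_zero_or_one (b : Fin 2) : b = 0 ∨ b = 1 := by fin_cases b <;> simp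

theorem fin_two_add_one_add_one (b : Fin 2) : b + 1 + 1 = b := by fin_cases b <;> rfl

theorem flipBit_flipBit (q : ι) (x : ι → Fin 2) : flipBit q (flipBit q x) = x := by
  simp [flipBit, fin_two_add_one_add_one]

theorem loc_pauliX_mulVec (q : ι) (v : Vec ι) (x : ι → Fin 2) :
    (loc q pauliX *ᵥ v) x = v (flipBit q x) := by
  rw [loc_mulVec_apply, Fin.sum_univ_two, flipBit]
  generalize x q = b
  fin_cases b <;> simp [pauliX]

/-- `(-1) ^ x q`. -/
def bitSign (q : ι) (x : ι → Fin 2) : ℝ := if x q = 0 then 1 else -1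

theorem loc_diag_mulVec (q : ι) (a b : ℂ) (v : Vec ι) (x : ι → Fin 2) :
    (loc q !![a, 0; 0, b] *ᵥ v) x = (if x q = 0 then a else b) * v x := by
  rw [loc_mulVec_apply, Fin.sum_univ_two]
  have hx := Function.update_eq_self q x
  rcases fin_two_eq_zero_or_one (x q) with h | h <;> rw [h] at hx <;> simp [h, hx]

theorem loc_pauliZ_mulVec (q : ι) (v : Vec ι) (x : ι → Fin 2) :
    (loc q pauliZ *ᵥ v) x = bitSign q x * v x := by
  rw [pauliZ, loc_diag_mulVec, bitSign]
  split_ifs <;> simp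

/-- The gate `exp (i π X / 4)`. -/
def sqrtX (q : ι) : Op ι :=
  ((Real.sqrt 2 : ℝ) : ℂ)⁻¹ • (1 + Complex.I • loc q pauliX)

theorem sqrtX_conjTranspose (q : ι) :
    (sqrtX q)ᴴ = ((Real.sqrt 2 : ℝ) : ℂ)⁻¹ • (1 - Complex.I • loc q pauliX) := by
  rw [sqrtX, Matrix.conjTranspose_smul, Matrix.conjTranspose_add, Matrix.conjTranspose_smul,
    loc_conjTranspose, pauliX_isHermitian.eq]
  simp [sub_eq_add_neg]

theorem sqrt_two_inv_mul_self : ((Real.sqrt 2 : ℝ) : ℂ)⁻¹ * ((Real.sqrt 2 : ℝ) : ℂ)⁻¹ = 1 / 2 := by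
  rw [← mul_inv, ← Complex.ofReal_mul, Real.mul_self_sqrt (by norm_num)]
  norm_num

theorem gate_sqrtX (q : ι) : Gate σ (sqrtX q) := by
  have hX := loc_mul_self pauliX_mul_self q
  have h2 : ((Real.sqrt 2 : ℝ) : ℂ)⁻¹ ≠ 0 := by simp
  refine ⟨?_, (sim_one_add_I_smul_pauliX q).smul h2, ?_⟩
  · rw [sqrtX_conjTranspose, sqrtX, smul_mul_smul_comm, sqrt_two_inv_mul_self]
    simp only [sub_mul, mul_add, one_mul, mul_one, smul_mul_smul_comm, hX, Complex.I_mul_I]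
    module
  · have : (1 : Op ι) - Complex.I • loc q pauliX =
        (-Complex.I) • (loc q pauliX * (1 + Complex.I • loc q pauliX)) := by
      rw [mul_add, mul_one, mul_smul_comm, hX, smul_add, smul_smul, neg_mul, Complex.I_mul_I]
      module
    rw [sqrtX_conjTranspose, this]
    exact (((sim_pauliX q).mul (sim_one_add_I_smul_pauliX q)).smul (by simp)).smul h2

theorem sqrtX_mulVec (q : ι) (v : Vec ι) (x : ι → Fin 2) :
    (sqrtX q *ᵥ v) x = ((Real.sqrt 2 : ℝ) : ℂ)⁻¹ * (v x + Complex.I * v (flipBit q x)) := by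
  simp [sqrtX, Matrix.smul_mulVec, Matrix.add_mulVec, loc_pauliX_mulVec, mul_add]

theorem sqrtX_conjTranspose_mulVec (q : ι) (v : Vec ι) (x : ι → Fin 2) :
    ((sqrtX q)ᴴ *ᵥ v) x = ((Real.sqrt 2 : ℝ) : ℂ)⁻¹ * (v x - Complex.I * v (flipBit q x)) := by
  simp [sqrtX_conjTranspose, Matrix.smul_mulVec, Matrix.sub_mulVec, loc_pauliX_mulVec, mul_sub]

/-- The action of a controlled `X` on basis states. -/
def cnotMap (q r : ι) (x : ι → Fin 2) : ι → Fin 2 := Function.update x r (x r + x q)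

theorem cnotMap_cnotMap {q r : ι} (hqr : q ≠ r) (x : ι → Fin 2) :
    cnotMap q r (cnotMap q r x) = x := by
  have : ∀ a b : Fin 2, a + b + b = a := by decide
  simp [cnotMap, hqr, this]

theorem cnot_mulVec {q r : ι} (hqr : q ≠ r) (v : Vec ι) (x : ι → Fin 2) :
    (cnot q r *ᵥ v) x = 2 * v (cnotMap q r x) := by
  simp only [cnot, Matrix.sub_mulVec, Matrix.add_mulVec, Matrix.one_mulVec, Pi.sub_apply,
    Pi.add_apply, ← Matrix.mulVec_mulVec, loc_pauliX_mulVec, loc_pauliZ_mulVec]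
  have h : bitSign q (flipBit r x) = bitSign q x := by simp [bitSign, flipBit, hqr]
  rw [h, bitSign]
  rcases fin_two_eq_zero_or_one (x q) with h₀ | h₁
  · simp only [cnotMap, h₀, add_zero, Function.update_eq_self, if_true]
    push_cast
    ring
  · simp only [cnotMap, flipBit, h₁, one_ne_zero, if_false]
    push_cast
    ring

theorem cnot_conjTranspose {q r : ι} (hqr : q ≠ r) : (cnot q r)ᴴ = cnot q r := by
  simp only [cnot, Matrix.conjTranspose_sub, Matrix.conjTranspose_add, Matrix.conjTranspose_one,
    Matrix.conjTranspose_mul, loc_conjTranspose, pauliX_isHermitian.eq, pauliZ_isHermitian.eq,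
    loc_comm hqr]

theorem gate_cnot {q r : ι} (hqr : q ≠ r) : Gate σ ((1 / 2 : ℂ) • cnot q r) := by
  have h : ((1 / 2 : ℂ) • cnot q r)ᴴ = (1 / 2 : ℂ) • cnot q r := by
    rw [Matrix.conjTranspose_smul, cnot_conjTranspose hqr]
    simp
  have hs : Sim σ ((1 / 2 : ℂ) • cnot q r) := (sim_cnot hqr).smul (by norm_num)
  refine ⟨?_, hs, h.symm ▸ hs⟩
  rw [h, Matrix.ext_iff_mulVec]
  intro v
  ext x
  simp [← Matrix.mulVec_mulVec, Matrix.smul_mulVec, cnot_mulVec hqr, cnotMap_cnotMap hqr]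

/-! ### Diagonal gates -/

variable (σ) in
/-- All real multiples of `f` are phases of gates. -/
def IsPhase (f : (ι → Fin 2) → ℝ) : Prop :=
  ∀ α : ℝ, Gate σ (Matrix.diagonal fun x => Complex.exp ((α * f x : ℝ) * Complex.I))

theorem IsPhase.add {f g : (ι → Fin 2) → ℝ} (hf : IsPhase σ f) (hg : IsPhase σ g) :
    IsPhase σ (f + g) := by
  intro α
  convert (hf α).mul (hg α) using 1
  rw [Matrix.diagonal_mul_diagonal]
  congr 1
  ext x
  rw [← Complex.exp_add]
  congr 1
  push_cast [Pi.add_apply]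
  ring

theorem IsPhase.smul {f : (ι → Fin 2) → ℝ} (hf : IsPhase σ f) (c : ℝ) : IsPhase σ (c • f) := by
  intro α
  convert hf (α * c) using 5
  simp [mul_assoc]

theorem IsPhase.const (c : ℝ) : IsPhase σ (fun _ : ι → Fin 2 => c) := by
  intro α
  convert (Gate.one (σ := σ)).smul (Complex.norm_exp_ofReal_mul_I (α * c)) using 1
  ext x y
  simp [Matrix.diagonal_apply, Matrix.one_apply]

theorem IsPhase.sum {J : Type*} (s : Finset J) {f : J → (ι → Fin 2) → ℝ}
    (hf : ∀ j ∈ s, IsPhase σ (f j)) : IsPhase σ (∑ j ∈ s, f j) := by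
  classical
  induction s using Finset.induction_on with
  | empty => exact IsPhase.const 0
  | insert j s hj ih =>
    rw [Finset.sum_insert hj]
    exact (hf j (Finset.mem_insert_self j s)).add
      (ih fun i hi => hf i (Finset.mem_insert_of_mem hi))

theorem isPhase_bitSign (q : ι) : IsPhase σ (bitSign q) := by
  intro α
  have h₁ := Complex.norm_exp_ofReal_mul_I α
  have h₂ := Complex.norm_exp_ofReal_mul_I (-2 * α)
  convert (gate_phase (σ := σ) q h₂).smul h₁ using 1
  rw [Matrix.ext_iff_mulVec]
  intro v
  ext x
  rw [Matrix.mulVec_diagonal, Matrix.smul_mulVec, Pi.smul_apply, phase, loc_diag_mulVec,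
    bitSign, smul_eq_mul, ← mul_assoc]
  congr 1
  split_ifs
  · simp
  · rw [← Complex.exp_add]
    congr 1
    push_cast
    ring

/-- CNOT permutes basis states, so conjugating a diagonal gate by it permutes the diagonal. -/
theorem IsPhase.comp_cnotMap {f : (ι → Fin 2) → ℝ} (hf : IsPhase σ f) {q r : ι} (hqr : q ≠ r) :
    IsPhase σ (f ∘ cnotMap q r) := by
  intro α
  convert ((gate_cnot hqr).mul (hf α)).mul (gate_cnot hqr) using 1
  rw [Matrix.ext_iff_mulVec]
  intro v
  ext x
  simp only [← Matrix.mulVec_mulVec, Matrix.smul_mulVec, Pi.smul_apply, cnot_mulVec hqr,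
    Matrix.mulVec_diagonal, cnotMap_cnotMap hqr, smul_eq_mul, Function.comp_apply]
  ring

/-- Fix one qubit `q` of the set as target. Each CNOT from another qubit `r` multiplies the sign of
`q` by that of `r` and leaves the other signs alone. -/
theorem isPhase_parity (s : Finset ι) : IsPhase σ fun x => ∏ i ∈ s, bitSign i x := by
  rcases s.eq_empty_or_nonempty with rfl | ⟨q, hq⟩
  · exact IsPhase.const 1
  · obtain ⟨t, hqt, rfl⟩ : ∃ t, q ∉ t ∧ s = insert q t :=
      ⟨s.erase q, Finset.notMem_erase q s, (Finset.insert_erase hq).symm⟩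
    clear hq
    induction t using Finset.induction_on with
    | empty => simpa using isPhase_bitSign q
    | insert r t hr ih =>
      have hqr : r ≠ q := fun h => hqt (h ▸ Finset.mem_insert_self r t)
      have hqt' : q ∉ t := fun h => hqt (Finset.mem_insert_of_mem h)
      convert (ih hqt').comp_cnotMap hqr using 1
      ext x
      have hsign : bitSign q (cnotMap r q x) = bitSign q x * bitSign r x := by
        have : ∀ a b : Fin 2, (if a + b = 0 then (1 : ℝ) else -1) =
            (if a = 0 then 1 else -1) * (if b = 0 then 1 else -1) := by
          intro a b
          fin_cases a <;> fin_cases b <;> simp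
        simp [bitSign, cnotMap, this]
      have hrest : ∏ i ∈ t, bitSign i (cnotMap r q x) = ∏ i ∈ t, bitSign i x :=
        Finset.prod_congr rfl fun i hi => by
          simp [bitSign, cnotMap, Function.update_of_ne (fun h : i = q => hqt' (h ▸ hi))]
      simp only [Function.comp_apply]
      rw [Finset.prod_insert hqt, Finset.prod_insert hr, Finset.prod_insert hqt', hsign, hrest]
      ring

theorem isPhase (f : (ι → Fin 2) → ℝ) : IsPhase σ f := by
  -- Expanding this product over subsets writes the indicator of `y`, times 2 to the number of
  -- qubits, as a combination of parities.
  have hδ : ∀ y x : ι → Fin 2, ∏ i, (1 + bitSign i y * bitSign i x) =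
      if y = x then 2 ^ Fintype.card ι else 0 := by
    intro y x
    split_ifs with h
    · subst h
      have : ∀ i, 1 + bitSign i y * bitSign i y = 2 := by
        intro i
        unfold bitSign
        split_ifs <;> norm_num
      simp [this]
    · obtain ⟨i, hi⟩ := Function.ne_iff.1 h
      refine Finset.prod_eq_zero (Finset.mem_univ i) ?_
      unfold bitSign
      rcases fin_two_eq_zero_or_one (y i) with h₁ | h₁ <;>
        rcases fin_two_eq_zero_or_one (x i) with h₂ | h₂ <;> simp [h₁, h₂] at hi ⊢
  have hf : f = ∑ y, (f y / 2 ^ Fintype.card ι) •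
      ∑ s : Finset ι, (∏ i ∈ s, bitSign i y) • fun x => ∏ i ∈ s, bitSign i x := by
    ext x
    simp only [Finset.sum_apply, Pi.smul_apply, smul_eq_mul, ← Finset.prod_mul_distrib]
    have : ∀ y, ∑ s : Finset ι, ∏ i ∈ s, bitSign i y * bitSign i x =
        if y = x then 2 ^ Fintype.card ι else 0 := by
      intro y
      rw [← hδ, Finset.prod_one_add, Finset.powerset_univ]
    simp [this]
  rw [hf]
  exact IsPhase.sum _ fun y _ => (IsPhase.sum _ fun s _ => (isPhase_parity s).smul _).smul _

theorem gate_diagonal {d : (ι → Fin 2) → ℂ} (hd : ∀ x, ‖d x‖ = 1) :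
    Gate σ (Matrix.diagonal d) := by
  convert isPhase (σ := σ) (fun x => (d x).arg) 1 using 2
  ext x
  have := Complex.norm_mul_exp_arg_mul_I (d x)
  rw [hd, Complex.ofReal_one, one_mul] at this
  rw [one_mul, this]

/-! ### Transitivity on states -/

theorem rotation_eq_zero (z : ℂ) : (z.im : ℂ) * (Complex.exp (-(z.arg * Complex.I)) +
      Complex.exp (z.arg * Complex.I)) + Complex.I * z.re * (Complex.exp (z.arg * Complex.I) -
      Complex.exp (-(z.arg * Complex.I))) = 0 := by
  have h₁ := Complex.norm_mul_cos_arg z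
  have h₂ := Complex.norm_mul_sin_arg z
  rw [← h₁, ← h₂, ← neg_mul, Complex.exp_mul_I, Complex.exp_mul_I, Complex.cos_neg,
    Complex.sin_neg]
  push_cast
  linear_combination (2 * ‖z‖ * Complex.cos z.arg * Complex.sin z.arg) * Complex.I_mul_I

/-- A gate that clears the amplitudes with bit `q` set. -/
theorem exists_gate_clear (q : ι) (v : Vec ι) : ∃ W, Gate σ W ∧
    (∀ x, x q = 1 → (W *ᵥ v) x = 0) ∧
    ∀ x, v x = 0 → v (flipBit q x) = 0 → (W *ᵥ v) x = 0 := by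
  -- `D₁` makes all amplitudes nonnegative. `D₂` conjugated by √X acts as exp(iτY) on each pair of
  -- states differing at `q`, a real rotation; τ is the polar angle of the pair of moduli, so the
  -- second entry becomes 0.
  let τ : (ι → Fin 2) → ℝ := fun x =>
    (⟨‖v (Function.update x q 0)‖, ‖v (Function.update x q 1)‖⟩ : ℂ).arg
  let D₁ : (ι → Fin 2) → ℂ := fun x => Complex.exp ((-(v x).arg : ℝ) * Complex.I)
  let D₂ : (ι → Fin 2) → ℂ := fun x => Complex.exp ((bitSign q x * τ x : ℝ) * Complex.I)
  have hD₁ : ∀ x, D₁ x * v x = ‖v x‖ := by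
    intro x
    conv_lhs => rw [← Complex.norm_mul_exp_arg_mul_I (v x)]
    rw [mul_left_comm, ← Complex.exp_add]
    simp
  refine ⟨sqrtX q * Matrix.diagonal D₂ * (sqrtX q)ᴴ * Matrix.diagonal D₁,
    (((gate_sqrtX q).mul (gate_diagonal fun x => Complex.norm_exp_ofReal_mul_I _)).mul
      (gate_sqrtX q).conjTranspose).mul (gate_diagonal fun x => Complex.norm_exp_ofReal_mul_I _),
    ?_, ?_⟩
  all_goals
    intro x
    simp only [← Matrix.mulVec_mulVec, sqrtX_mulVec, Matrix.mulVec_diagonal,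
      sqrtX_conjTranspose_mulVec, flipBit_flipBit, hD₁]
  · intro hx
    have h₀ : flipBit q x = Function.update x q 0 := by rw [flipBit, hx]; rfl
    have h₁ : x = Function.update x q 1 := by rw [← hx, Function.update_eq_self]
    have hτ : τ (flipBit q x) = τ x := by simp [τ, flipBit]
    have hs : bitSign q x = -1 := by simp [bitSign, hx]
    have hs' : bitSign q (flipBit q x) = 1 := by simp [bitSign, h₀]
    have key := rotation_eq_zero ⟨‖v (Function.update x q 0)‖, ‖v (Function.update x q 1)‖⟩
    rw [← h₀, ← h₁] at key
    have hτx : τ x = (⟨‖v (flipBit q x)‖, ‖v x‖⟩ : ℂ).arg := by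
      simp only [τ]
      rw [← h₀, ← h₁]
    simp only [D₂, hs, hs', hτ, hτx]
    simp only at key
    have e₁ : ∀ t : ℝ, (((-1 : ℝ) * t : ℝ) : ℂ) * Complex.I = -(t * Complex.I) := by
      intro t; push_cast; ring
    rw [e₁, one_mul]
    generalize Complex.exp (-(((⟨‖v (flipBit q x)‖, ‖v x‖⟩ : ℂ).arg : ℂ) * Complex.I)) = A at *
    generalize Complex.exp (((⟨‖v (flipBit q x)‖, ‖v x‖⟩ : ℂ).arg : ℂ) * Complex.I) = B at *
    linear_combination ((Real.sqrt 2 : ℝ) : ℂ)⁻¹ * ((Real.sqrt 2 : ℝ) : ℂ)⁻¹ * key -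
      ((Real.sqrt 2 : ℝ) : ℂ)⁻¹ * ((Real.sqrt 2 : ℝ) : ℂ)⁻¹ * B * ‖v x‖ * Complex.I_mul_I
  · intro h₁ h₂
    simp [h₁, h₂]

/-- Clear one qubit after another; clearing `q` mixes only amplitudes that differ at `q`, so zeros
caused by other qubits persist. -/
theorem exists_gate_supported (v : Vec ι) (s : Finset ι) :
    ∃ W, Gate σ W ∧ ∀ x, (∃ q ∈ s, x q = 1) → (W *ᵥ v) x = 0 := by
  induction s using Finset.induction_on with
  | empty => exact ⟨1, Gate.one, by simp⟩
  | insert q s hq ih =>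
    obtain ⟨W, hW, h⟩ := ih
    obtain ⟨W', hW', h₁, h₂⟩ := exists_gate_clear (σ := σ) q (W *ᵥ v)
    refine ⟨W' * W, hW'.mul hW, ?_⟩
    rintro x ⟨p, hp, hx⟩
    rw [← Matrix.mulVec_mulVec]
    rcases Finset.mem_insert.1 hp with rfl | hp
    · exact h₁ x hx
    · refine h₂ x (h x ⟨p, hp, hx⟩) (h _ ⟨p, hp, ?_⟩)
      rwa [flipBit, Function.update_of_ne fun h : p = q => hq (h ▸ hp)]

theorem exists_gate_mulVec_eq_single (v : Vec ι) :
    ∃ W, Gate σ W ∧ ∃ c : ℂ, W *ᵥ v = c • Pi.single 0 1 := by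
  obtain ⟨W, hW, h⟩ := exists_gate_supported (σ := σ) v Finset.univ
  refine ⟨W, hW, (W *ᵥ v) 0, funext fun x => ?_⟩
  by_cases hx : x = 0
  · simp [hx]
  · obtain ⟨q, hq⟩ := Function.ne_iff.1 hx
    rw [h x ⟨q, Finset.mem_univ q, Fin.eq_one_of_ne_zero _ hq⟩]
    simp [hx]

/-! ### Reflections generate the unitary group -/

theorem normSq_single (x : ι → Fin 2) : normSq (Pi.single x 1 : Vec ι) = 1 := by
  rw [normSq, Finset.sum_eq_single x]
  · simp
  · intro b _ hb
    simp [hb]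
  · simp

/-- Conjugate diag(ω, 1, …, 1) by a gate that carries `d` to a multiple of the zero basis state. -/
theorem gate_reflection {d : Vec ι} (hd : normSq d ≠ 0) {ω : ℂ} (hω : ‖ω‖ = 1) :
    Gate σ (1 + ((ω - 1) / normSq d) • Matrix.vecMulVec d (star d)) := by
  obtain ⟨W, hW, c, hc⟩ := exists_gate_mulVec_eq_single (σ := σ) d
  set e : Vec ι := Pi.single 0 1 with he
  have hd' : d = c • (Wᴴ *ᵥ e) := by
    rw [← Matrix.mulVec_smul, ← hc, Matrix.mulVec_mulVec, hW.conjTranspose_mul, Matrix.one_mulVec]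
  have hn : (normSq d : ℂ) = c * star c := by
    rw [← normSq_mulVec hW.conjTranspose_mul, hc, normSq_smul]
    rw [he, normSq_single, Complex.star_def, Complex.mul_conj']
    simp
  have hn0 : c * star c ≠ 0 := by
    rw [← hn]
    exact_mod_cast hd
  have hdiag : Matrix.diagonal (fun x : ι → Fin 2 => if x = 0 then ω else 1) =
      1 + (ω - 1) • Matrix.vecMulVec e (star e) := by
    ext x y
    by_cases hxy : x = y
    · subst hxy
      by_cases hx : x = 0 <;> simp [he, hx, Matrix.vecMulVec_apply]
    · by_cases hx : x = 0
      · subst hx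
        simp [he, Ne.symm hxy, hxy, Matrix.vecMulVec_apply]
      · simp [he, hx, hxy, Matrix.vecMulVec_apply]
  have hg : Gate σ (Matrix.diagonal (fun x : ι → Fin 2 => if x = 0 then ω else 1)) :=
    gate_diagonal fun x => by split_ifs <;> simp [hω]
  convert (hW.conjTranspose.mul hg).mul hW using 1
  rw [hdiag, mul_add, mul_one, add_mul, hW.conjTranspose_mul, mul_smul_comm, smul_mul_assoc,
    Matrix.mul_vecMulVec, Matrix.vecMulVec_mul, hn]
  congr 1
  have : star e ᵥ* W = star (Wᴴ *ᵥ e) := by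
    rw [Matrix.star_mulVec, Matrix.conjTranspose_conjTranspose]
  rw [this]
  generalize Wᴴ *ᵥ e = u at *
  rw [hd', star_smul, Matrix.smul_vecMulVec, Matrix.vecMulVec_smul, smul_smul, smul_smul]
  congr 1
  rw [mul_assoc, div_mul_cancel₀ _ hn0]

/-- Two vectors of norm one are exchanged by a gate that fixes the vectors orthogonal to their
difference. -/
theorem exists_gate_of_normSq_eq_one {e v : Vec ι} (he : normSq e = 1) (hv : normSq v = 1) :
    ∃ W, Gate σ W ∧ W *ᵥ e = v ∧ ∀ y, star (v - e) ⬝ᵥ y = 0 → W *ᵥ y = y := by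
  by_cases hne : v = e
  · exact ⟨1, Gate.one, by simp [hne], by simp⟩
  set d := v - e with hd
  have hd0 : normSq d ≠ 0 := fun h => hne (sub_eq_zero.1 (eq_zero_of_normSq_eq_zero h))
  have hee : star e ⬝ᵥ e = 1 := by rw [← ofReal_normSq, he, Complex.ofReal_one]
  have hvv : star v ⬝ᵥ v = 1 := by rw [← ofReal_normSq, hv, Complex.ofReal_one]
  set β := star v ⬝ᵥ e with hβ
  have hβ' : star e ⬝ᵥ v = star β := by rw [hβ, Matrix.star_dotProduct, dotProduct_comm]
  have hN : (normSq d : ℂ) = (1 - star β) + (1 - β) := by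
    rw [ofReal_normSq, hd, star_sub, sub_dotProduct, dotProduct_sub, dotProduct_sub, hee, hvv,
      hβ', ← hβ]
    ring
  have hβ1 : 1 - β ≠ 0 := by
    intro h
    rw [sub_eq_zero] at h
    rw [← h] at hN
    simp at hN
    exact hd0 hN
  have hd0' : (normSq d : ℂ) ≠ 0 := by exact_mod_cast hd0
  -- The reflection adds (ω - 1)(β - 1)/‖d‖² times `d` to `e`. Requiring this factor to be 1, with
  -- ‖d‖² = (1 - β̄) + (1 - β), determines ω, a quotient of conjugates up to sign and so of modulus
  -- one.
  refine ⟨_, gate_reflection hd0 (ω := -((1 - star β) / (1 - β))) ?_, ?_, ?_⟩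
  · have : 1 - star β = star (1 - β) := by simp
    rw [norm_neg, norm_div, this, norm_star, div_self (norm_ne_zero_iff.2 hβ1)]
  · have hde : star d ⬝ᵥ e = β - 1 := by rw [hd, star_sub, sub_dotProduct, hee, ← hβ]
    rw [Matrix.add_mulVec, Matrix.smul_mulVec, Matrix.vecMulVec_mulVec, hde, Matrix.one_mulVec,
      op_smul_eq_smul, smul_smul]
    have : (-((1 - star β) / (1 - β)) - 1) / (normSq d : ℂ) * (β - 1) = 1 := by
      rw [hN] at hd0' ⊢
      field_simp
      ring
    rw [this, one_smul, hd, add_sub_cancel]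
  · intro y hy
    rw [Matrix.add_mulVec, Matrix.smul_mulVec, Matrix.vecMulVec_mulVec, hy, Matrix.one_mulVec]
    simp

/-- Householder induction on the number of basis vectors not known to be fixed. A gate W carries a
new basis vector to its image under U; the vectors already fixed are orthogonal to both, so W fixes
them, and W⁻¹U fixes one vector more. -/
theorem gate_of_fixed (n : ℕ) (T : Finset (ι → Fin 2)) (hT : Tᶜ.card = n) (U : Op ι)
    (hU : Uᴴ * U = 1) (hUT : ∀ x ∈ T, U *ᵥ Pi.single x 1 = Pi.single x 1) : Gate σ U := by
  induction n generalizing T U with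
  | zero =>
    have hT' : ∀ x, x ∈ T := fun x => by
      have := Finset.card_eq_zero.1 hT
      by_contra hx
      have h : x ∈ Tᶜ := Finset.mem_compl.2 hx
      simp [this] at h
    obtain rfl : U = 1 := by
      ext x y
      have := congrFun (hUT y (hT' y)) x
      rw [Matrix.mulVec_single_one] at this
      rw [Matrix.one_apply, ← Pi.single_apply y (1 : ℂ) x, ← this]
      rfl
    exact Gate.one
  | succ n ih =>
    obtain ⟨x₀, hx₀⟩ : Tᶜ.Nonempty := Finset.card_pos.1 (by omega)
    have hUn := normSq_mulVec hU (Pi.single x₀ 1)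
    rw [normSq_single] at hUn
    obtain ⟨W, hW, hWe, hWy⟩ := exists_gate_of_normSq_eq_one (σ := σ) (normSq_single x₀) hUn
    have hWT : ∀ x ∈ T, W *ᵥ Pi.single x 1 = Pi.single x 1 := by
      intro x hx
      have hxx₀ : x₀ ≠ x := fun h => Finset.mem_compl.1 hx₀ (h ▸ hx)
      have horth : star (U *ᵥ Pi.single x₀ 1) ⬝ᵥ (Pi.single x 1 : Vec ι) = 0 := by
        rw [← hUT x hx, Matrix.star_mulVec, Matrix.dotProduct_mulVec, Matrix.vecMul_vecMul, hU,
          Matrix.vecMul_one]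
        simp [hxx₀]
      apply hWy
      rw [star_sub, sub_dotProduct, horth]
      simp [hxx₀]
    have key : ∀ {y z : Vec ι}, W *ᵥ y = z → Wᴴ *ᵥ z = y := by
      rintro y _ rfl
      rw [Matrix.mulVec_mulVec, hW.conjTranspose_mul, Matrix.one_mulVec]
    have hg : Gate σ (Wᴴ * U) := by
      refine ih (insert x₀ T) ?_ _ ?_ ?_
      · rw [Finset.compl_insert, Finset.card_erase_of_mem hx₀, hT, Nat.add_sub_cancel]
      · rw [Matrix.conjTranspose_mul, Matrix.conjTranspose_conjTranspose, mul_assoc,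
          ← mul_assoc W, hW.mul_conjTranspose, one_mul, hU]
      · intro x hx
        rw [← Matrix.mulVec_mulVec]
        rcases Finset.mem_insert.1 hx with rfl | hx
        · exact key hWe
        · rw [hUT x hx, key (hWT x hx)]
    have := hW.mul hg
    rwa [← mul_assoc, hW.mul_conjTranspose, one_mul] at this

theorem gate_of_unitary {U : Op ι} (hU : Uᴴ * U = 1) : Gate σ U :=
  gate_of_fixed _ ∅ rfl U hU (by simp)

end Universality

/-! ### Projective measurements -/

section Projective

variable {ι κ R J : Type} [Fintype ι] [DecidableEq ι] [Fintype κ] [DecidableEq κ]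

theorem simulates_of_impl {n m : ℕ} {A : J → Op (Fin n)}
    (h : Impl F2 fun j => {B | ∃ K, B = ten (Equiv.refl (Fin n ⊕ Fin m)) (A j) K}) :
    Simulates F2 A := by
  obtain ⟨P, hP, h⟩ := h
  refine ⟨m, P, hP.tendsto, fun k B hB χ => ?_⟩
  obtain ⟨K, rfl⟩ := h k B hB
  exact ⟨K *ᵥ χ, fun φ => ten_mulVec_tensorVec _ _ _ _⟩

/-- Regard the last of the qubits of the first part as belonging to the second part. -/
def regroup (ι : Type) : (ι ⊕ Fin 1) ⊕ Fin 1 ≃ ι ⊕ Fin (1 + 1) :=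
  (Equiv.sumAssoc _ _ _).trans ((Equiv.refl ι).sumCongr finSumFinEquiv)

theorem ten_regroup (A : Op ι) (B C : Op (Fin 1)) :
    ten (regroup ι) (ten (Equiv.refl _) A B) C =
      ten (Equiv.refl _) A (ten finSumFinEquiv B C) := by
  ext x y
  exact mul_assoc _ _ _

/-- Invert an additional qubit if the state lies in the range of the projection `p`. -/
def controlledX (p : Op ι) : Op (ι ⊕ Fin 1) :=
  ten (Equiv.refl _) p (loc 0 pauliX) + ten (Equiv.refl _) (1 - p) 1

theorem controlledX_unitary {p : Op ι} (hp : IsStarProjection p) :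
    (controlledX p)ᴴ * controlledX p = 1 := by
  have hH : pᴴ = p := hp.isSelfAdjoint
  have h₁ : p * p = p := hp.isIdempotentElem
  have h₂ : p * (1 - p) = 0 := by rw [mul_sub, mul_one, h₁, sub_self]
  have h₃ : (1 - p) * p = 0 := by rw [sub_mul, one_mul, h₁, sub_self]
  have h₄ : (1 - p) * (1 - p) = 1 - p := by rw [mul_sub, mul_one, h₃, sub_zero]
  have hz : ∀ B, ten (Equiv.refl (ι ⊕ Fin 1)) (0 : Op ι) B = 0 := fun B => by
    ext x y; simp [ten]
  simp only [controlledX, Matrix.conjTranspose_add, ten_conjTranspose, Matrix.conjTranspose_sub,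
    Matrix.conjTranspose_one, hH, loc_conjTranspose, pauliX_isHermitian.eq, add_mul, mul_add,
    ten_mul, h₁, h₂, h₃, h₄, hz, loc_mul_self pauliX_mul_self, mul_one, add_zero, zero_add]
  rw [← ten_add_left, add_sub_cancel, ten_one_one]

theorem specProj_mul_specProj_not {O : Op ι} (hO : O * O = 1) (s : Bool) :
    specProj O (!s) * specProj O s = 0 := by
  cases s <;>
  · simp only [specProj_eq, sgn, smul_mul_assoc, mul_smul_comm, add_mul, mul_add, hO, mul_one,
      one_mul, Bool.not_true, Bool.not_false, if_true, if_false, Bool.false_eq_true]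
    module

theorem specProj_mul_mul_specProj {O O' : Op ι} (hO : O * O = 1) (hOO' : O * O' = -(O' * O))
    (s : Bool) : specProj O s * O' * specProj O s = 0 := by
  have : specProj O s * O' = O' * specProj O (!s) := by
    cases s <;>
    · simp only [specProj_eq, sgn, smul_mul_assoc, mul_smul_comm, add_mul, mul_add, hOO', mul_one,
        one_mul, Bool.not_true, Bool.not_false, if_true, if_false, Bool.false_eq_true]
      module
  rw [this, mul_assoc, specProj_mul_specProj_not hO, mul_zero]

/-- Between two Z measurements of the flag, the X branch of `controlledX` survives only if the
outcomes differ and the identity branch only if they agree. One of the two extra qubits is the flag;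
the other serves to simulate `controlledX`. -/
theorem impl_projection {p : Op ι} (hp : IsStarProjection p) :
    Impl F2 fun b : Bool => {B | ∃ K, B =
      ten (Equiv.refl (ι ⊕ Fin (1 + 1))) (if b then p else 1 - p) K} := by
  have hV : Sim (regroup ι) (controlledX p) := (gate_of_unitary (controlledX_unitary hp)).sim
  have hZ := loc_mul_self pauliZ_mul_self (0 : Fin 1)
  have hloc : ∀ s, specProj (loc (regroup ι (.inl (.inr 0))) pauliZ) s =
      ten (regroup ι) (ten (Equiv.refl _) 1 (specProj (loc 0 pauliZ) s)) 1 := by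
    intro s
    rw [loc_inl, specProj_ten_one_right]
    congr 1
    exact (congrArg (specProj · s) (loc_inr (Equiv.refl (ι ⊕ Fin 1)) 0 pauliZ)).trans
      (specProj_ten_one_left _ _ _)
  refine Impl.measure_Z (regroup ι (.inl (.inr 0))) fun s => ?_
  refine Impl.bind hV fun _ => ?_
  refine Impl.measure_Z (regroup ι (.inl (.inr 0))) fun t => ?_
  refine Impl.halt (t != s) ?_
  rintro _ ⟨K, rfl⟩
  have key : ten (Equiv.refl (ι ⊕ Fin 1)) 1 (specProj (loc 0 pauliZ) t) * controlledX p *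
      ten (Equiv.refl _) 1 (specProj (loc 0 pauliZ) s) =
      ten (Equiv.refl _) p (specProj (loc 0 pauliZ) t * loc 0 pauliX * specProj (loc 0 pauliZ) s) +
      ten (Equiv.refl _) (1 - p) (specProj (loc 0 pauliZ) t * specProj (loc 0 pauliZ) s) := by
    simp only [controlledX, mul_add, add_mul, ten_mul, one_mul, mul_one]
  have hz : ∀ A : Op ι, ten (Equiv.refl (ι ⊕ Fin 1)) A 0 = 0 := fun B => by
    ext x y; simp [ten]
  simp only [Set.mem_ofPred_eq]
  rw [one_mul, hloc, hloc, ten_mul, ten_mul, one_mul, mul_one, key]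
  rcases Bool.eq_or_eq_not t s with rfl | rfl
  · rw [specProj_mul_mul_specProj hZ (by rw [loc_mul, loc_mul, pauliZ_mul_pauliX, loc_neg]), hz,
      zero_add, ten_regroup]
    exact ⟨_, congrArg (ten _ · _) (by simp)⟩
  · rw [specProj_mul_specProj_not hZ, hz, add_zero, ten_regroup]
    exact ⟨_, congrArg (ten _ · _) (by simp)⟩

/-- Orthogonality follows from completeness, since ‖φ‖² = ∑ ‖p_k φ‖². For φ = p_j ψ the j-th term
already equals the left side, so all others vanish. -/
theorem mul_eq_zero_of_sum_eq_one {J : Type*} [Fintype J] {p : J → Op ι}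
    (hp : ∀ k, IsStarProjection (p k)) (hsum : ∑ k, p k = 1) {j k : J} (hjk : j ≠ k) :
    p k * p j = 0 := by
  classical
  have hn : ∀ φ : Vec ι, normSq φ = ∑ k, normSq (p k *ᵥ φ) := by
    intro φ
    have : ((normSq φ : ℝ) : ℂ) = ((∑ k, normSq (p k *ᵥ φ) : ℝ) : ℂ) := by
      push_cast
      simp only [ofReal_normSq, Matrix.star_mulVec, Matrix.dotProduct_mulVec,
        Matrix.vecMul_vecMul]
      have h : ∀ k, (p k)ᴴ * p k = p k := fun k => by
        have hH : (p k)ᴴ = p k := (hp k).isSelfAdjoint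
        rw [hH]
        exact (hp k).isIdempotentElem
      simp only [h]
      rw [← sum_dotProduct, ← Matrix.vecMul_sum, hsum, Matrix.vecMul_one]
    exact_mod_cast this
  rw [Matrix.ext_iff_mulVec]
  intro ψ
  rw [← Matrix.mulVec_mulVec, Matrix.zero_mulVec]
  apply eq_zero_of_normSq_eq_zero
  have h := hn (p j *ᵥ ψ)
  have hj : p j *ᵥ (p j *ᵥ ψ) = p j *ᵥ ψ := by
    rw [Matrix.mulVec_mulVec, (hp j).isIdempotentElem.eq]
  rw [← Finset.add_sum_erase _ _ (Finset.mem_univ j), hj, left_eq_add] at h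
  rw [Finset.sum_eq_zero_iff_of_nonneg fun _ _ => normSq_nonneg _] at h
  exact h k (Finset.mem_erase.2 ⟨hjk.symm, Finset.mem_univ k⟩)

/-- Test the projections successively. By orthogonality p_j leaves p_j of the remainder 1 - ∑ p_k,
and 1 - p_j leaves the next remainder; `none` means that no test has succeeded yet. -/
theorem impl_option_projection {r : ℕ} {p : Fin r → Op ι} (hp : ∀ k, IsStarProjection (p k))
    (hsum : ∑ k, p k = 1) (s : Finset (Fin r)) :
    Impl F2 fun o : Option (Fin r) => {B | ∃ K, B =
      ten (Equiv.refl (ι ⊕ Fin (1 + 1))) (o.elim (1 - ∑ k ∈ s, p k) p) K} := by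
  induction s using Finset.induction_on with
  | empty => exact Impl.halt none ⟨1, by simp [ten_one_one]⟩
  | insert j s hj ih =>
    have horth : p j * ∑ k ∈ s, p k = 0 := by
      rw [Finset.mul_sum]
      refine Finset.sum_eq_zero fun k hk => mul_eq_zero_of_sum_eq_one hp hsum ?_
      exact fun h => hj (h ▸ hk)
    refine ih.bind fun o => ?_
    cases o with
    | some k =>
      refine Impl.halt (some k) ?_
      rintro _ ⟨K, rfl⟩
      exact ⟨K, one_mul _⟩
    | none =>
      refine (impl_projection (hp j)).bind fun b => Impl.halt (if b then some j else none) ?_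
      rintro _ ⟨K', rfl⟩ _ ⟨K, rfl⟩
      refine ⟨K' * K, ?_⟩
      rw [one_mul, ten_mul]
      congr 1
      cases b
      · simp only [Bool.false_eq_true, if_false, Option.elim_none, Finset.sum_insert hj, sub_mul,
          mul_sub, one_mul, mul_one, horth]
        abel
      · simp only [if_true, Option.elim_none, Option.elim_some, mul_sub, mul_one, horth, sub_zero]

theorem simulates_projections {n r : ℕ} {p : Fin r → Op (Fin n)}
    (hp : ∀ k, IsStarProjection (p k)) (hsum : ∑ k, p k = 1) : Simulates F2 p := by
  -- An empty sum cannot be the identity. `k₀` is a default result for the branch where every test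
  -- fails.
  obtain ⟨k₀⟩ : Nonempty (Fin r) := by
    by_contra h
    rw [not_nonempty_iff] at h
    simp at hsum
  refine simulates_of_impl (m := 1 + 1)
    ((impl_option_projection hp hsum Finset.univ).bind fun o => Impl.halt (o.getD k₀) ?_)
  rintro _ ⟨K, rfl⟩
  cases o with
  | some k => exact ⟨K, one_mul _⟩
  | none =>
    -- After all tests the remainder is 1 - ∑ p_k = 0, so the operator of this branch is zero and
    -- any result label is correct.
    refine ⟨0, ?_⟩
    rw [hsum, one_mul]
    ext x y
    simp [ten]

theorem simulates_unitary {n : ℕ} {U : Op (Fin n)}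
    (hU : U ∈ Matrix.unitaryGroup (Fin n → Fin 2) ℂ) : Simulates F2 fun _ : Unit => U :=
  simulates_of_impl (gate_of_unitary (σ := Equiv.refl (Fin n ⊕ Fin 1))
    (Matrix.mem_unitaryGroup_iff'.1 hU)).sim

end Projective

end MBQC

end

theorem theorem1 : MBQC.IsQuantumUniversal MBQC.F2 :=
  fun _ => ⟨fun _ hU => MBQC.simulates_unitary hU,
    fun _ _ hp hsum => MBQC.simulates_projections hp hsum⟩
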